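/- Let $\Omega\subset\mathbb{R}^2$ be a bounded polygonal domain (a bounded, connected, nonempty open set whose boundary is a finite union of line segments). Let $\mathcal{T}_{h_0}$, $h_0>0$, be a conforming triangulation of $\Omega$: finitely many nondegenerate triangles that cover exactly $\overline\Omega$, any two of which meet in the convex hull of their common vertices, and such that $\partial\Omega$ is a union of edges. Let $I=\{h_0/2^k : k=0,1,2,\dots\}$, and for $h\in I$ let $\mathcal{T}_{h/2}$ be the Goursat refinement of $\mathcal{T}_h$, in which each triangle is cut into four along the three lines joining the midpoints of its edges. Let $$\mathcal{V}_h=\{u\in C(\overline\Omega): u|_T \text{ is affine for all } T\in\mathcal{T}_h,\ u|_{\partial\Omega}=0\},$$ let $P_1^h,\dots,P_{N_h}^h$ be the vertices of $\mathcal{T}_h$ that lie in $\Omega$, with nodal basis functions $\varphi_1^h,\dots,\varphi_{N_h}^h$, and let $\mathcal{I}_h(f)=\sum_{i=1}^{N_h} f(P_i^h)\,\varphi_i^h$ be the nodal interpolant. Write $\mathcal{D}_\rho u=\rho u$ and $\mathcal{D}^h_{\sigma}u=\mathcal{I}_h(\sigma u)$. Let $\|\cdot\|$ be the norm of $L^2(\Omega)$,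 let $\|u\|_{H^1(\Omega)}=(\|u\|^2+\|\partial_1u\|^2+\|\partial_2u\|^2)^{1/2}$, and for $\rho\in W^2_\infty(\Omega)$ let $$\|\rho\|_{W^2_\infty(\Omega)/\mathbb{R}}=\max_{1\le|\alpha|\le2}\|\partial^\alpha\rho\|_{L^\infty(\Omega)} .$$ Then there is a constant $C>0$, which depends only on $\Omega$, $\mathcal{T}_{h_0}$ and $h_0$, such that every real-valued $\rho\in W^2_\infty(\Omega)$ has a representative that is continuous on $\Omega$ (whose values at the nodes define $\mathcal{I}_h(\rho)$), and, with $\rho_h=\mathcal{I}_h(\rho)$, $$\|(\mathcal{D}_\rho-\mathcal{D}^h_{\rho_h})u\|\le C\,h^2\,\|\rho\|_{W^2_\infty(\Omega)/\mathbb{R}}\,\|u\|_{H^1(\Omega)}\qquad\text{for all } h\in I,\ u\in\mathcal{V}_h .$$ -/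

import Mathlib

open MeasureTheory Set
open scoped ENNReal ContDiff

noncomputable section

namespace P1FEM

/-- The Euclidean plane `ℝ²`. -/
abbrev Plane : Type := EuclideanSpace ℝ (Fin 2)

/-- Nondegenerate triangles in the plane, given by their three vertices.  The closed triangle
is `t.closedInterior`. -/
abbrev Tri : Type := Affine.Triangle ℝ Plane

/-! ### Sobolev spaces through weak derivatives -/

/-- The classical partial derivative `∂ᵢ φ`. -/
def pderiv (i : Fin 2) (φ : Plane → ℝ) : Plane → ℝ :=
  fun x => fderiv ℝ φ x (EuclideanSpace.single i 1)

/-- The classical partial derivative `∂^α φ = ∂₀^{α₀} ∂₁^{α₁} φ`. -/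
def mpderiv (α : Fin 2 → ℕ) (φ : Plane → ℝ) : Plane → ℝ :=
  (pderiv 0)^[α 0] ((pderiv 1)^[α 1] φ)

/-- The length `|α|` of a multi-index. -/
def mlen (α : Fin 2 → ℕ) : ℕ := α 0 + α 1

/-- `g` is the weak derivative `∂^α f` on the open set `Ω`:
`∫_Ω f ∂^α φ = (-1)^{|α|} ∫_Ω g φ` for all `φ ∈ C_c^∞(Ω)`. -/
def IsWeakDeriv (Ω : Set Plane) (α : Fin 2 → ℕ) (f g : Plane → ℝ) : Prop :=
  LocallyIntegrableOn f Ω ∧ LocallyIntegrableOn g Ω ∧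
    ∀ φ : Plane → ℝ, ContDiff ℝ ∞ φ → HasCompactSupport φ → tsupport φ ⊆ Ω →
      ∫ x in Ω, f x * mpderiv α φ x = (-1) ^ mlen α * ∫ x in Ω, g x * φ x

/-- Membership in the Sobolev space `W^m_p(Ω)`. -/
def MemSobolev (Ω : Set Plane) (m : ℕ) (p : ℝ≥0∞) (f : Plane → ℝ) : Prop :=
  MemLp f p (volume.restrict Ω) ∧
    ∀ α : Fin 2 → ℕ, mlen α ≤ m →
      ∃ g : Plane → ℝ, IsWeakDeriv Ω α f g ∧ MemLp g p (volume.restrict Ω)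

/-- The norm `‖∂^α f‖_{L^p(Ω)}` of a weak derivative.  Weak derivatives are unique almost
everywhere, so that the infimum is over a single value when `∂^α f` exists; it is `∞` when
`∂^α f` does not exist. -/
def weakDerivNorm (Ω : Set Plane) (α : Fin 2 → ℕ) (p : ℝ≥0∞) (f : Plane → ℝ) : ℝ≥0∞ :=
  ⨅ (g : Plane → ℝ) (_ : IsWeakDeriv Ω α f g), eLpNorm g p (volume.restrict Ω)

/-- The `L²(Ω)` norm. -/
def L2Norm (Ω : Set Plane) (f : Plane → ℝ) : ℝ≥0∞ := eLpNorm f 2 (volume.restrict Ω)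

/-- The norm `‖f‖_{H¹(Ω)} = (‖f‖² + ‖∂₀ f‖² + ‖∂₁ f‖²)^{1/2}` (all norms in `L²(Ω)`). -/
def H1Norm (Ω : Set Plane) (f : Plane → ℝ) : ℝ≥0∞ :=
  (L2Norm Ω f ^ 2 + ∑ i : Fin 2, weakDerivNorm Ω (Pi.single i 1) 2 f ^ 2) ^ (1 / 2 : ℝ)

/-- The quotient norm
`‖ρ‖_{W²_∞(Ω)/ℝ} = max_{1 ≤ |α| ≤ 2} ‖∂^α ρ‖_{L^∞(Ω)}`. -/
def W2infQuotNorm (Ω : Set Plane) (ρ : Plane → ℝ) : ℝ≥0∞ :=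
  ⨆ (α : Fin 2 → ℕ) (_ : 1 ≤ mlen α ∧ mlen α ≤ 2), weakDerivNorm Ω α ∞ ρ

/-! ### Polygonal domains, triangulations, Goursat refinement -/

/-- A bounded polygonal domain: a bounded, connected, nonempty open subset of the plane whose
boundary is a finite union of line segments. -/
def IsPolygonalDomain (Ω : Set Plane) : Prop :=
  IsOpen Ω ∧ IsConnected Ω ∧ Bornology.IsBounded Ω ∧
    ∃ S : Finset (Plane × Plane), (∀ p ∈ S, p.1 ≠ p.2) ∧
      frontier Ω = ⋃ p ∈ S, segment ℝ p.1 p.2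

/-- A finite family of triangles is a (conforming) triangulation of `Ω`. -/
structure IsTriangulation (𝒯 : Finset Tri) (Ω : Set Plane) : Prop where
  /-- The triangles cover exactly the closure of the domain. -/
  cover : ⋃ t ∈ 𝒯, t.closedInterior = closure Ω
  /-- Two triangles meet exactly in the convex hull of their common vertices, that is, in the
  empty set, a common vertex, a common edge, or they coincide. -/
  conforming : ∀ t ∈ 𝒯, ∀ t' ∈ 𝒯,
    t.closedInterior ∩ t'.closedInterior =
      convexHull ℝ (range t.points ∩ range t'.points)
  /-- The boundary of the domain is a union of edges of triangles. -/
  boundary : ∀ x ∈ frontier Ω, ∃ t ∈ 𝒯, ∃ i j : Fin 3, i ≠ j ∧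
    x ∈ segment ℝ (t.points i) (t.points j) ∧
    segment ℝ (t.points i) (t.points j) ⊆ frontier Ω

/-- The subtriangle of `t` at its `i`-th vertex: its vertices are the `i`-th vertex and the
midpoints of the two edges through that vertex. -/
def cornerTri (t : Tri) (i : Fin 3) : Tri where
  points j := midpoint ℝ (t.points i) (t.points j)
  independent := by
    have h := t.independent.map' (AffineMap.homothety (t.points i) (1 / 2 : ℝ))
      (fun x y hxy => by
        simpa [AffineMap.homothety_apply] using hxy)
    have e : (fun j => midpoint ℝ (t.points i) (t.points j)) =
        (AffineMap.homothety (t.points i) (1 / 2 : ℝ)) ∘ t.points := by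
      funext j
      simp [AffineMap.homothety_eq_lineMap, midpoint]
    rw [e]
    exact h

/-- The central subtriangle of `t`, whose vertices are the midpoints of the edges of `t`
(the `j`-th vertex is the midpoint of the edge opposite to the `j`-th vertex of `t`). -/
def centralTri (t : Tri) : Tri where
  points j := midpoint ℝ (t.points (j + 1)) (t.points (j + 2))
  independent := by
    have h := t.medial.independent
    have e : (fun j : Fin 3 => midpoint ℝ (t.points (j + 1)) (t.points (j + 2))) =
        t.medial.points := by
      funext j
      rw [Affine.Simplex.medial_points,
        Affine.Simplex.faceOppositeCentroid_eq_sum_vsub_vadd, midpoint_eq_smul_add]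
      ext k
      fin_cases j <;> simp [Fin.sum_univ_three] <;> ring
    rw [e]
    exact h

open Classical in
/-- The Goursat refinement: each triangle is cut along the three lines that join the midpoints
of its edges. -/
def goursat (𝒯 : Finset Tri) : Finset Tri :=
  𝒯.biUnion fun t => insert (centralTri t) (Finset.univ.image (cornerTri t))

/-- The `k`-th mesh `𝒯_h`, `h = h₀ / 2 ^ k`, obtained from the initial mesh by `k` successive
Goursat refinements. -/
def mesh (𝒯₀ : Finset Tri) (k : ℕ) : Finset Tri := goursat^[k] 𝒯₀

/-! ### Continuous piecewise linear elements -/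

/-- The space `V_h` of the mesh `𝒯`: functions that are continuous on the closure of `Ω`,
linear (that is, affine) on each triangle and zero on the boundary of `Ω`.  Values outside the
closure of `Ω` play no role. -/
def FESpace (Ω : Set Plane) (𝒯 : Finset Tri) : Set (Plane → ℝ) :=
  {u | ContinuousOn u (closure Ω) ∧
    (∀ t ∈ 𝒯, ∃ A : Plane →ᵃ[ℝ] ℝ, EqOn u A t.closedInterior) ∧
    ∀ x ∈ frontier Ω, u x = 0}

open Classical in
/-- The nodes (vertices of triangles) of the mesh that lie in the domain `Ω` itself. -/
def interiorNodes (Ω : Set Plane) (𝒯 : Finset Tri) : Finset Plane :=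
  (𝒯.biUnion fun t => Finset.univ.image t.points).filter (· ∈ Ω)

/-- The standard nodal basis function `φ_P` of the node `P`: on a triangle that has `P` as a
vertex, its value at `x` is the barycentric coordinate of `x` that belongs to `P`; on all other
triangles it is zero.  (In a conforming mesh the set below has at most one element, and `sSup`
extracts this element; `sSup ∅ = 0`.) -/
def hat (𝒯 : Finset Tri) (P x : Plane) : ℝ :=
  sSup {c : ℝ | ∃ t ∈ 𝒯, ∃ i : Fin 3, t.points i = P ∧
    ∃ w ∈ stdSimplex ℝ (Fin 3), ∑ j, w j • t.points j = x ∧ c = w i}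

/-- The nodal interpolation operator `I_h f = ∑ᵢ f(Pᵢ) φᵢ`, with the sum over the nodes in `Ω`. -/
def interp (Ω : Set Plane) (𝒯 : Finset Tri) (f : Plane → ℝ) : Plane → ℝ :=
  fun x => ∑ P ∈ interiorNodes Ω 𝒯, f P * hat 𝒯 P x

/-- The multiplication operator `D_ρ u = ρ u`. -/
def mulOp (ρ u : Plane → ℝ) : Plane → ℝ := fun x => ρ x * u x

/-- The discrete multiplication operator `D^h_σ u = I_h (σ u)`. -/
def discMulOp (Ω : Set Plane) (𝒯 : Finset Tri) (σ u : Plane → ℝ) : Plane → ℝ :=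
  interp Ω 𝒯 (mulOp σ u)

end P1FEM

end

namespace P1FEM

/-! The estimate is pointwise on each triangle. Let `x` be an interior point of a triangle with
vertices `P i` and barycentric coordinates `w i`, and put `a i = u (P i)`. Since `u` is affine there
and vanishes at boundary nodes, the error at `x` is, up to sign, `∑ w i * a i * (ρ (P i) - ρ x)`.
The sum `∑ w i * ∇ρ(x)(P i - x)` is zero, so `u x` times it may be subtracted. What remains is `∑ w
i * ((a i - u x) * ∇ρ(x)(P i - x) + a i * R i)` with `R i` the Taylor remainder. The first term is
of size `h² |∇u| |∇ρ|`, the second `h² (|u| + h |∇u|) |∇²ρ|`. Only derivatives of `ρ` occur, whence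
the quotient norm; squaring and integrating gives the claim (`abs_sum_mul_sub_le`,
`L2Norm_le_mul_H1Norm`).

Two points need care. The nodal basis is defined by a supremum over all triangles, so barycentric
coordinates must agree where triangles meet. This follows from conformity on the initial mesh and is
inherited by refinement (`IsTriangulation.consistent`, `Consistent.goursat`).

Moreover `ρ` is only in `W²_∞`. Its mollifications keep the derivative bounds on compact subsets of
`Ω` and are locally equi-Lipschitz, so they converge everywhere in `Ω` to a continuous
representative, and the pointwise estimate passes to the limit (`MemSobolev.exists_smoothApprox`,
`SmoothApprox.exists_continuousOn`, `SmoothApprox.abs_sum_mul_sub_le`). -/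

/-! ### Barycentric coordinates in one triangle. -/

/-- The combination of the vertices of `t` with the weights `w`. -/
def comb (t : Tri) (w : Fin 3 → ℝ) : Plane := ∑ j, w j • t.points j

lemma mem_closedInterior_iff_comb {t : Tri} {x : Plane} :
    x ∈ t.closedInterior ↔ ∃ w ∈ stdSimplex ℝ (Fin 3), comb t w = x := by
  constructor
  · rintro ⟨w, hw, h0, rfl⟩
    refine ⟨w, ⟨fun i => (h0 i).1, hw⟩, ?_⟩
    rw [Finset.affineCombination_eq_linear_combination _ _ _ hw]
    rfl
  · rintro ⟨w, hw, rfl⟩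
    refine ⟨w, hw.2, fun i => mem_Icc_of_mem_stdSimplex hw i, ?_⟩
    rw [Finset.affineCombination_eq_linear_combination _ _ _ hw.2]
    rfl

lemma comb_injective {t : Tri} {v w : Fin 3 → ℝ} (hv : ∑ i, v i = 1) (hw : ∑ i, w i = 1)
    (h : comb t v = comb t w) : v = w := by
  refine (affineIndependent_iff_eq_of_fintype_affineCombination_eq ℝ t.points).1
    t.independent v w hv hw ?_
  rw [Finset.affineCombination_eq_linear_combination _ _ _ hv,
    Finset.affineCombination_eq_linear_combination _ _ _ hw]
  exact h

lemma comb_combo (t : Tri) (v w : Fin 3 → ℝ) (a b : ℝ) :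
    comb t (a • v + b • w) = a • comb t v + b • comb t w := by
  simp [comb, add_smul, mul_smul, Finset.sum_add_distrib, Finset.smul_sum]

lemma comb_single (t : Tri) (i : Fin 3) : comb t (Pi.single i 1) = t.points i := by
  simp [comb, Pi.single_apply]

lemma map_comb (A : Plane →ᵃ[ℝ] ℝ) (t : Tri) {w : Fin 3 → ℝ} (hw : ∑ i, w i = 1) :
    A (comb t w) = ∑ i, w i * A (t.points i) := by
  have h := Finset.univ.map_affineCombination t.points w hw A
  rw [Finset.affineCombination_eq_linear_combination _ _ _ hw,
    Finset.affineCombination_eq_linear_combination _ _ _ hw] at h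
  exact h

/-- At a topologically interior point of a triangle all barycentric coordinates are positive. -/
lemma pos_of_comb_mem_interior {t : Tri} {w : Fin 3 → ℝ} (hw : w ∈ stdSimplex ℝ (Fin 3))
    (h : comb t w ∈ interior t.closedInterior) (i : Fin 3) : 0 < w i := by
  have hc : Continuous fun s : ℝ => comb t w + s • (comb t w - t.points i) := by fun_prop
  have h0 : ∀ᶠ s in nhds (0 : ℝ), comb t w + s • (comb t w - t.points i) ∈ t.closedInterior := by
    refine hc.continuousAt.eventually_mem (mem_interior_iff_mem_nhds.1 (by simpa using h))
  obtain ⟨s, hs, hs0⟩ := ((h0.filter_mono nhdsWithin_le_nhds).and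
    (self_mem_nhdsWithin (s := Ioi (0 : ℝ)))).exists
  obtain ⟨v, hv, hvs⟩ := mem_closedInterior_iff_comb.1 hs
  have hs0 : 0 < s := hs0
  -- Moving away from vertex `i` by a small `s > 0` stays in the triangle, so the new coordinate `(1
  -- + s) * w i - s` is nonnegative and `w i > 0`.
  have key : v = fun j => (1 + s) * w j - s * (Pi.single i 1 : Fin 3 → ℝ) j := by
    refine comb_injective (t := t) hv.2 ?_ ?_
    · rw [Finset.sum_sub_distrib, ← Finset.mul_sum, ← Finset.mul_sum, hw.2]
      simp
    · rw [hvs]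
      conv_lhs => rw [← comb_single t i]
      simp only [comb, sub_smul, mul_smul, Finset.sum_sub_distrib, ← Finset.smul_sum]
      module
  have := hv.1 i
  rw [key] at this
  simp only [Pi.single_eq_same, mul_one] at this
  nlinarith

lemma add_le_one_of_mem_stdSimplex {v : Fin 3 → ℝ} (hv : v ∈ stdSimplex ℝ (Fin 3)) {a b : Fin 3}
    (hab : a ≠ b) : v a + v b ≤ 1 := by
  rw [← hv.2, ← Finset.sum_pair hab]
  exact Finset.sum_le_sum_of_subset_of_nonneg (Finset.subset_univ _) fun i _ _ => hv.1 i

/-! ### The children of a triangle -/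

open Classical in
lemma mem_goursat {𝒯 : Finset Tri} {c : Tri} :
    c ∈ goursat 𝒯 ↔ ∃ t ∈ 𝒯, c = centralTri t ∨ ∃ i, c = cornerTri t i := by
  simp [goursat, eq_comm]

lemma comb_cornerTri (t : Tri) (i : Fin 3) {v : Fin 3 → ℝ} (hv : ∑ j, v j = 1) :
    comb (cornerTri t i) v = comb t (fun j => v j / 2 + if j = i then 1 / 2 else 0) := by
  have h : comb (cornerTri t i) v = ∑ j, ((1 / 2 * v j) • t.points i + (v j / 2) • t.points j) := by
    refine Finset.sum_congr rfl fun j _ => ?_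
    change v j • midpoint ℝ (t.points i) (t.points j) = _
    rw [midpoint_eq_smul_add, invOf_eq_inv]
    module
  rw [h, Finset.sum_add_distrib, ← Finset.sum_smul, ← Finset.mul_sum, hv]
  simp only [comb, add_smul, Finset.sum_add_distrib, ite_smul, zero_smul, Finset.sum_ite_eq',
    Finset.mem_univ, if_true]
  rw [mul_one, add_comm]

lemma comb_centralTri (t : Tri) {v : Fin 3 → ℝ} (hv : ∑ j, v j = 1) :
    comb (centralTri t) v = comb t (fun j => (1 - v j) / 2) := by
  rw [Fin.sum_univ_three] at hv
  have h0 : v 0 = 1 - v 1 - v 2 := by linarith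
  simp only [comb, Fin.sum_univ_three, centralTri, midpoint_eq_smul_add, invOf_eq_inv, h0]
  simp only [Fin.reduceAdd, zero_add]
  module

/-- The two-sided description of the barycentric coordinates `v` with respect to a child `c` of
`t` through the coordinates `w` with respect to `t`. -/
structure ChildCoords (t c : Tri) (w v : Fin 3 → ℝ) : Prop where
  mem : w ∈ stdSimplex ℝ (Fin 3)
  comb_eq : comb t w = comb c v
  -- The formulas do not depend on which child `c` is. Where positive, they are the refined hat
  -- functions of a vertex and of an edge midpoint. The terms of the minimum are the affine pieces
  -- of the latter: `w j` in the corner at `i`, `w i` in the corner at `j`, and `w i + w j - 1 / 2`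
  -- in the centre.
  vertex_or_mid : ∀ m, v m ≠ 0 →
    (∃ i, c.points m = t.points i ∧ 1 / 2 < w i ∧ v m = 2 * w i - 1) ∨
    (∃ i j, i ≠ j ∧ c.points m = midpoint ℝ (t.points i) (t.points j) ∧ 0 < w i ∧ 0 < w j ∧
      1 / 2 < w i + w j ∧ v m = 2 * min (min (w i) (w j)) (w i + w j - 1 / 2))
  vertex : ∀ i, 1 / 2 < w i → ∃ m, c.points m = t.points i ∧ v m = 2 * w i - 1
  mid : ∀ i j, i ≠ j → 0 < w i → 0 < w j → 1 / 2 < w i + w j →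
    ∃ m, c.points m = midpoint ℝ (t.points i) (t.points j) ∧
      v m = 2 * min (min (w i) (w j)) (w i + w j - 1 / 2)

lemma childCoords_cornerTri (t : Tri) (i : Fin 3) {v : Fin 3 → ℝ}
    (hv : v ∈ stdSimplex ℝ (Fin 3)) :
    ChildCoords t (cornerTri t i) (fun j => v j / 2 + if j = i then 1 / 2 else 0) v := by
  have h0 := hv.1
  have h1 : ∀ j, v j ≤ 1 := fun j => (mem_Icc_of_mem_stdSimplex hv j).2
  refine ⟨⟨fun j => ?_, ?_⟩, (comb_cornerTri t i hv.2).symm, fun m hm => ?_, fun j hj => ?_,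
    fun a b hab ha hb hs => ?_⟩
  · have := h0 j
    dsimp only
    split_ifs <;> linarith
  · rw [Finset.sum_add_distrib, ← Finset.sum_div, hv.2]
    simp
    norm_num
  · have hm' : 0 < v m := lt_of_le_of_ne (h0 m) hm.symm
    by_cases him : m = i
    · subst him
      refine Or.inl ⟨m, by simp [cornerTri], ?_, ?_⟩ <;> simp only [if_true] <;> linarith
    · refine Or.inr ⟨i, m, Ne.symm him, rfl, ?_, ?_, ?_, ?_⟩ <;> simp only [if_true, if_neg him] <;>
        have := h0 i <;> have := h1 m
      · linarith
      · linarith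
      · linarith
      · rw [min_eq_right (a := v i / 2 + 1 / 2) (by linarith), min_eq_left (by linarith)]
        linarith
  · by_cases h : j = i
    · subst h
      refine ⟨j, by simp [cornerTri], ?_⟩
      simp only [if_true]; linarith
    · simp only [if_neg h] at hj
      linarith [h1 j]
  · by_cases hai : a = i
    · subst hai
      refine ⟨b, rfl, ?_⟩
      simp only [if_true, if_neg hab.symm] at *
      have := h0 a
      have := h1 b
      rw [min_eq_right (a := v a / 2 + 1 / 2) (by linarith), min_eq_left (by linarith)]
      linarith
    · by_cases hbi : b = i
      · subst hbi
        refine ⟨a, midpoint_comm _ _, ?_⟩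
        simp only [if_true, if_neg hab] at *
        have := h0 b
        have := h1 a
        rw [min_eq_left (b := v b / 2 + 1 / 2) (by linarith), min_eq_left (by linarith)]
        linarith
      · simp only [if_neg hai, if_neg hbi] at hs
        linarith [add_le_one_of_mem_stdSimplex hv hab]

/-- In the central child every parental coordinate is at most `1 / 2`, so no old vertex is active
and the minimum is its third term. -/
lemma childCoords_centralTri (t : Tri) {v : Fin 3 → ℝ} (hv : v ∈ stdSimplex ℝ (Fin 3)) :
    ChildCoords t (centralTri t) (fun j => (1 - v j) / 2) v := by
  have h0 := hv.1
  have h1 : ∀ j, v j ≤ 1 := fun j => (mem_Icc_of_mem_stdSimplex hv j).2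
  have hsum : ∀ m, v m + v (m + 1) + v (m + 2) = 1 := by
    intro m
    rw [← hv.2, Fin.sum_univ_three]
    fin_cases m <;> simp <;> ring
  have hval : ∀ m, v m = 2 * min (min ((1 - v (m + 1)) / 2) ((1 - v (m + 2)) / 2))
      ((1 - v (m + 1)) / 2 + (1 - v (m + 2)) / 2 - 1 / 2) := by
    intro m
    have := hsum m
    have := h0 (m + 1)
    have := h0 (m + 2)
    rw [min_eq_right (le_min (by linarith) (by linarith))]
    linarith
  refine ⟨⟨fun j => ?_, ?_⟩, (comb_centralTri t hv.2).symm, fun m hm => ?_, fun j hj => ?_,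
    fun a b hab ha hb hs => ?_⟩
  · have := h1 j
    dsimp only
    linarith
  · rw [← Finset.sum_div, Finset.sum_sub_distrib, hv.2]
    simp
    norm_num
  · have hm' : 0 < v m := lt_of_le_of_ne (h0 m) hm.symm
    have := hsum m
    have := h0 (m + 1)
    have := h0 (m + 2)
    refine Or.inr ⟨m + 1, m + 2, by fin_cases m <;> decide, rfl, ?_, ?_, ?_, hval m⟩ <;> linarith
  · linarith [h0 j]
  · obtain ⟨m, hm⟩ : ∃ m : Fin 3, (a = m + 1 ∧ b = m + 2) ∨ (a = m + 2 ∧ b = m + 1) := by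
      clear * - hab
      decide +revert
    rcases hm with ⟨rfl, rfl⟩ | ⟨rfl, rfl⟩
    · exact ⟨m, rfl, hval m⟩
    · refine ⟨m, midpoint_comm _ _, ?_⟩
      rw [min_comm ((1 - v (m + 2)) / 2), add_comm ((1 - v (m + 2)) / 2)]
      exact hval m

lemma exists_childCoords {𝒯 : Finset Tri} {c : Tri} (hc : c ∈ goursat 𝒯) :
    ∃ t ∈ 𝒯, ∀ v ∈ stdSimplex ℝ (Fin 3), ∃ w, ChildCoords t c w v := by
  obtain ⟨t, ht, rfl | ⟨i, rfl⟩⟩ := mem_goursat.1 hc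
  · exact ⟨t, ht, fun v hv => ⟨_, childCoords_centralTri t hv⟩⟩
  · exact ⟨t, ht, fun v hv => ⟨_, childCoords_cornerTri t i hv⟩⟩

/-! ### Consistency of barycentric coordinates in a mesh -/

/-- Points common to several triangles have the same barycentric coordinates in each. -/
def Consistent (𝒯 : Finset Tri) : Prop :=
  ∀ t ∈ 𝒯, ∀ t' ∈ 𝒯, ∀ w ∈ stdSimplex ℝ (Fin 3), ∀ w' ∈ stdSimplex ℝ (Fin 3),
    comb t w = comb t' w' → ∀ i, w i ≠ 0 → ∃ j, t'.points j = t.points i ∧ w' j = w i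

/-- A common point of two children has matching coordinates in both parents, and the child
coordinates are label-free functions of these. -/
lemma Consistent.goursat {𝒯 : Finset Tri} (h : Consistent 𝒯) : Consistent (goursat 𝒯) := by
  intro c hc c' hc' v hv v' hv' hvv m hm
  obtain ⟨t, ht, hw⟩ := exists_childCoords hc
  obtain ⟨t', ht', hw'⟩ := exists_childCoords hc'
  obtain ⟨w, hw⟩ := hw v hv
  obtain ⟨w', hw'⟩ := hw' v' hv'
  have key := h t ht t' ht' w hw.mem w' hw'.mem (by rw [hw.comb_eq, hw'.comb_eq, hvv])
  rcases hw.vertex_or_mid m hm with ⟨i, hi, hi2, hvi⟩ | ⟨i, j, hij, hm, hi, hj, hs, hvi⟩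
  · obtain ⟨j, hj, hj2⟩ := key i (by linarith)
    obtain ⟨l, hl, hl2⟩ := hw'.vertex j (by linarith)
    exact ⟨l, by rw [hl, hj, hi], by rw [hl2, hj2, hvi]⟩
  · obtain ⟨i', hi', hi2⟩ := key i hi.ne'
    obtain ⟨j', hj', hj2⟩ := key j hj.ne'
    have hne : i' ≠ j' := by
      rintro rfl
      exact hij (t.independent.injective (hi'.symm.trans hj'))
    obtain ⟨l, hl, hl2⟩ := hw'.mid i' j' hne (by rwa [hi2]) (by rwa [hj2]) (by rwa [hi2, hj2])
    exact ⟨l, by rw [hl, hi', hj', hm], by rw [hl2, hi2, hj2, hvi]⟩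

-- The points with matching coordinates in `t` and `t'` form a convex set containing the common
-- vertices. By conformity it contains the whole intersection, and barycentric coordinates are
-- unique.
open Classical in
lemma IsTriangulation.consistent {𝒯 : Finset Tri} {Ω : Set Plane} (h : IsTriangulation 𝒯 Ω) :
    Consistent 𝒯 := by
  intro t ht t' ht' w hw w' hw' hww i hi
  -- The weight is regarded as a function of the vertex as a point, which makes different triangles
  -- comparable.
  let B : Tri → (Fin 3 → ℝ) → Plane → ℝ := fun t w P => ∑ i, if t.points i = P then w i else 0
  have hBv : ∀ (t : Tri) w i, B t w (t.points i) = w i := fun t w i => by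
    simp [B, t.independent.injective.eq_iff]
  let S : Set Plane := {x | ∃ w ∈ stdSimplex ℝ (Fin 3), ∃ w' ∈ stdSimplex ℝ (Fin 3),
    comb t w = x ∧ comb t' w' = x ∧ B t w = B t' w'}
  have hS : Convex ℝ S := by
    rintro x ⟨w, hw, w', hw', h1, h2, h3⟩ y ⟨v, hv, v', hv', g1, g2, g3⟩ a b ha hb hab
    have hB : ∀ (t : Tri) w v, B t (a • w + b • v) = a • B t w + b • B t v := by
      intro t w v
      ext P
      simp only [B, Pi.add_apply, Pi.smul_apply, smul_eq_mul, Finset.mul_sum,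
        ← Finset.sum_add_distrib]
      refine Finset.sum_congr rfl fun j _ => ?_
      split_ifs <;> simp
    exact ⟨_, convex_stdSimplex ℝ _ hw hv ha hb hab, _, convex_stdSimplex ℝ _ hw' hv' ha hb hab,
      by rw [comb_combo, h1, g1], by rw [comb_combo, h2, g2], by rw [hB, hB, h3, g3]⟩
  have hx : comb t w ∈ convexHull ℝ (range t.points ∩ range t'.points) := by
    rw [← h.conforming t ht t' ht']
    exact ⟨mem_closedInterior_iff_comb.2 ⟨w, hw, rfl⟩,
      mem_closedInterior_iff_comb.2 ⟨w', hw', hww.symm⟩⟩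
  have hsub : range t.points ∩ range t'.points ⊆ S := by
    rintro _ ⟨⟨a, rfl⟩, ⟨b, hb⟩⟩
    refine ⟨_, single_mem_stdSimplex ℝ a, _, single_mem_stdSimplex ℝ b, comb_single t a,
      by rw [comb_single, hb], ?_⟩
    ext P
    simp only [B, Pi.single_apply, ← ite_and]
    rw [Finset.sum_eq_single a, Finset.sum_eq_single b] <;> simp +contextual [hb]
  obtain ⟨v, hv, v', hv', h1, h2, h3⟩ := convexHull_min hsub hS hx
  obtain rfl : v = w := comb_injective hv.2 hw.2 h1
  obtain rfl : v' = w' := comb_injective hv'.2 hw'.2 (h2.trans hww)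
  have h4 := congrFun h3 (t.points i)
  rw [hBv] at h4
  by_cases hj : ∃ j, t'.points j = t.points i
  · obtain ⟨j, hj⟩ := hj
    refine ⟨j, hj, ?_⟩
    rw [h4, ← hj, hBv]
  · push Not at hj
    exact absurd (h4.trans (by simp [B, hj])) hi

lemma IsTriangulation.consistent_mesh {𝒯 : Finset Tri} {Ω : Set Plane}
    (h : IsTriangulation 𝒯 Ω) (k : ℕ) : Consistent (mesh 𝒯 k) := by
  induction k with
  | zero => exact h.consistent
  | succ k ih => rw [mesh, Function.iterate_succ_apply']; exact ih.goursat

/-- Nodal basis functions are given by barycentric coordinates. -/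
lemma Consistent.hat_points {𝒯 : Finset Tri} (h : Consistent 𝒯) {t : Tri} (ht : t ∈ 𝒯)
    {w : Fin 3 → ℝ} (hw : w ∈ stdSimplex ℝ (Fin 3)) (i : Fin 3) :
    hat 𝒯 (t.points i) (comb t w) = w i := by
  have : {c : ℝ | ∃ t' ∈ 𝒯, ∃ j : Fin 3, t'.points j = t.points i ∧
      ∃ w' ∈ stdSimplex ℝ (Fin 3), ∑ l, w' l • t'.points l = comb t w ∧ c = w' j} = {w i} := by
    ext c
    simp only [mem_ofPred_eq, mem_singleton_iff]
    constructor
    · rintro ⟨t', ht', j, hj, w', hw', hc, rfl⟩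
      by_contra hne
      by_cases h0 : w i = 0
      · obtain ⟨l, hl, hl2⟩ := h t' ht' t ht w' hw' w hw hc j (by rwa [h0] at hne)
        obtain rfl := t.independent.injective (hl.trans hj)
        exact hne hl2.symm
      · obtain ⟨l, hl, hl2⟩ := h t ht t' ht' w hw w' hw' hc.symm i h0
        obtain rfl := t'.independent.injective (hl.trans hj.symm)
        exact hne hl2
    · rintro rfl
      exact ⟨t, ht, i, rfl, w, hw, rfl, rfl⟩
  rw [hat, this, csSup_singleton]

lemma Consistent.hat_of_notMem {𝒯 : Finset Tri} (h : Consistent 𝒯) {t : Tri} (ht : t ∈ 𝒯)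
    {w : Fin 3 → ℝ} (hw : w ∈ stdSimplex ℝ (Fin 3)) {P : Plane} (hP : P ∉ range t.points) :
    hat 𝒯 P (comb t w) = 0 := by
  have : {c : ℝ | ∃ t' ∈ 𝒯, ∃ j : Fin 3, t'.points j = P ∧
      ∃ w' ∈ stdSimplex ℝ (Fin 3), ∑ l, w' l • t'.points l = comb t w ∧ c = w' j} ⊆ {0} := by
    rintro c ⟨t', ht', j, rfl, w', hw', hc, rfl⟩
    by_contra hne
    obtain ⟨l, hl, hl2⟩ := h t' ht' t ht w' hw' w hw hc j hne
    exact hP ⟨l, hl⟩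
  -- The set is empty or `{0}`; `sSup` is zero in both cases.
  rcases subset_singleton_iff_eq.1 this with h | h <;> rw [hat, h] <;> simp

open Classical in
lemma Consistent.interp_comb {𝒯 : Finset Tri} (h : Consistent 𝒯) (Ω : Set Plane) (f : Plane → ℝ)
    {t : Tri} (ht : t ∈ 𝒯) {w : Fin 3 → ℝ} (hw : w ∈ stdSimplex ℝ (Fin 3)) :
    interp Ω 𝒯 f (comb t w) = ∑ i, w i * if t.points i ∈ Ω then f (t.points i) else 0 := by
  have h1 : interp Ω 𝒯 f (comb t w) = ∑ P ∈ (Finset.univ.image t.points).filter (· ∈ Ω),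
      f P * hat 𝒯 P (comb t w) := by
    refine (Finset.sum_subset ?_ ?_).symm
    · intro P hP
      simp only [Finset.mem_filter, interiorNodes] at hP ⊢
      exact ⟨Finset.mem_biUnion.2 ⟨t, ht, hP.1⟩, hP.2⟩
    · intro P hP hP'
      simp only [interiorNodes, Finset.mem_filter] at hP
      rw [h.hat_of_notMem ht hw, mul_zero]
      rintro ⟨i, rfl⟩
      exact hP' (by simp [hP.2])
  rw [h1, Finset.sum_filter, Finset.sum_image t.independent.injective.injOn]
  refine Finset.sum_congr rfl fun i _ => ?_
  rw [h.hat_points ht hw]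
  split_ifs <;> ring

lemma Consistent.interp_points {𝒯 : Finset Tri} (h : Consistent 𝒯) {Ω : Set Plane}
    (f : Plane → ℝ) {t : Tri} (ht : t ∈ 𝒯) {i : Fin 3} (hi : t.points i ∈ Ω) :
    interp Ω 𝒯 f (t.points i) = f (t.points i) := by
  classical
  conv_lhs => rw [← comb_single t i]
  rw [h.interp_comb Ω f ht (single_mem_stdSimplex ℝ i)]
  rw [Finset.sum_eq_single i] <;> simp +contextual [hi]

/-! ### Covering, inclusion and size -/

/-- A coordinate of at least `1 / 2` puts the point in that corner child; if there is none, it is in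
the central child. -/
lemma exists_mem_goursat_of_mem {𝒯 : Finset Tri} {t : Tri} (ht : t ∈ 𝒯) {x : Plane}
    (hx : x ∈ t.closedInterior) : ∃ c ∈ goursat 𝒯, x ∈ c.closedInterior := by
  obtain ⟨w, hw, rfl⟩ := mem_closedInterior_iff_comb.1 hx
  have h0 := hw.1
  by_cases h : ∃ i, 1 / 2 ≤ w i
  · obtain ⟨i, hi⟩ := h
    have hv1 : ∑ j, (2 * w j - if j = i then 1 else 0) = 1 := by
      rw [Finset.sum_sub_distrib, ← Finset.mul_sum, hw.2]
      simp
      norm_num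
    refine ⟨cornerTri t i, mem_goursat.2 ⟨t, ht, Or.inr ⟨i, rfl⟩⟩, mem_closedInterior_iff_comb.2
      ⟨fun j => 2 * w j - if j = i then 1 else 0, ⟨fun j => ?_, hv1⟩, ?_⟩⟩
    · have := h0 j
      dsimp only
      split_ifs with hj
      · subst hj; linarith
      · linarith
    · rw [comb_cornerTri t i hv1]
      congr 1
      ext j
      split_ifs <;> ring
  · push Not at h
    have hv1 : ∑ j, (1 - 2 * w j) = 1 := by
      rw [Finset.sum_sub_distrib, ← Finset.mul_sum, hw.2]
      simp
      norm_num
    refine ⟨centralTri t, mem_goursat.2 ⟨t, ht, Or.inl rfl⟩, mem_closedInterior_iff_comb.2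
      ⟨fun j => 1 - 2 * w j, ⟨fun j => ?_, hv1⟩, ?_⟩⟩
    · have := h j
      dsimp only
      linarith
    · rw [comb_centralTri t hv1]
      congr 1
      ext j
      ring

lemma exists_superset_of_mem_goursat {𝒯 : Finset Tri} {c : Tri} (hc : c ∈ goursat 𝒯) :
    ∃ t ∈ 𝒯, c.closedInterior ⊆ t.closedInterior := by
  obtain ⟨t, ht, h⟩ := exists_childCoords hc
  refine ⟨t, ht, fun x hx => ?_⟩
  obtain ⟨v, hv, rfl⟩ := mem_closedInterior_iff_comb.1 hx
  obtain ⟨w, hw⟩ := h v hv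
  exact mem_closedInterior_iff_comb.2 ⟨w, hw.mem, hw.comb_eq⟩

lemma IsTriangulation.cover_mesh {𝒯 : Finset Tri} {Ω : Set Plane} (h : IsTriangulation 𝒯 Ω)
    (k : ℕ) {x : Plane} (hx : x ∈ closure Ω) : ∃ t ∈ mesh 𝒯 k, x ∈ t.closedInterior := by
  induction k with
  | zero => simpa [mesh, ← h.cover] using hx
  | succ k ih =>
    obtain ⟨t, ht, hxt⟩ := ih
    rw [mesh, Function.iterate_succ_apply']
    exact exists_mem_goursat_of_mem ht hxt

lemma exists_superset_of_mem_mesh {𝒯 : Finset Tri} (k : ℕ) :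
    ∀ c ∈ mesh 𝒯 k, ∃ t ∈ 𝒯, c.closedInterior ⊆ t.closedInterior := by
  induction k with
  | zero => exact fun c hc => ⟨c, hc, subset_rfl⟩
  | succ k ih =>
    intro c hc
    rw [mesh, Function.iterate_succ_apply'] at hc
    obtain ⟨t, ht, hct⟩ := exists_superset_of_mem_goursat hc
    obtain ⟨s, hs, hts⟩ := ih t ht
    exact ⟨s, hs, hct.trans hts⟩

lemma IsTriangulation.closedInterior_subset_closure {𝒯 : Finset Tri} {Ω : Set Plane}
    (h : IsTriangulation 𝒯 Ω) {k : ℕ} {t : Tri} (ht : t ∈ mesh 𝒯 k) :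
    t.closedInterior ⊆ closure Ω := by
  obtain ⟨s, hs, hts⟩ := exists_superset_of_mem_mesh k t ht
  rw [← h.cover]
  exact hts.trans (subset_biUnion_of_mem (u := fun t : Tri => t.closedInterior) hs)

/-- The interior of a triangle does not meet the boundary of the domain. -/
lemma IsTriangulation.interior_subset_domain {𝒯 : Finset Tri} {Ω : Set Plane}
    (h : IsTriangulation 𝒯 Ω) {k : ℕ} {t : Tri} (ht : t ∈ mesh 𝒯 k) :
    interior t.closedInterior ⊆ Ω := by
  intro x hx
  by_contra hxΩ
  have hxf : x ∈ frontier Ω :=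
    ⟨h.closedInterior_subset_closure ht (interior_subset hx), fun h' => hxΩ (interior_subset h')⟩
  obtain ⟨s, hs, hts⟩ := exists_superset_of_mem_mesh k t ht
  replace hx := interior_mono hts hx
  obtain ⟨w, hw, rfl⟩ := mem_closedInterior_iff_comb.1 (interior_subset hx)
  obtain ⟨s', hs', i, j, hij, ⟨a, b, ha, hb, hab, hxs⟩, -⟩ := h.boundary _ hxf
  -- On a boundary edge of `s'` the third vertex has weight zero. But consistency matches the three
  -- vertices of `s`, all of positive weight, injectively and hence bijectively with those of `s'`.
  let w' : Fin 3 → ℝ := a • Pi.single i 1 + b • Pi.single j 1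
  have hw' : w' ∈ stdSimplex ℝ (Fin 3) := convex_stdSimplex ℝ _
    (single_mem_stdSimplex ℝ i) (single_mem_stdSimplex ℝ j) ha hb hab
  have hc : comb s w = comb s' w' := by
    rw [comb_combo, comb_single, comb_single, hxs]
  have key := h.consistent s hs s' hs' w hw w' hw' hc
  choose f hf hf2 using fun i => key i (pos_of_comb_mem_interior hw hx i).ne'
  have hfi : Function.Injective f := fun p q hpq =>
    s.independent.injective (by rw [← hf, ← hf, hpq])
  obtain ⟨l, hl⟩ : ∃ l : Fin 3, l ≠ i ∧ l ≠ j := by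
    clear * -
    decide +revert
  obtain ⟨m, rfl⟩ := (Finite.injective_iff_surjective.1 hfi) l
  have h0 := hf2 m
  simp only [w', Pi.add_apply, Pi.smul_apply, Pi.single_apply, if_neg hl.1, if_neg hl.2] at h0
  have := pos_of_comb_mem_interior hw hx m
  simp at h0
  linarith

lemma dist_points_le_of_mem_mesh {𝒯 : Finset Tri} {D : ℝ}
    (hD : ∀ t ∈ 𝒯, ∀ i j, ‖t.points i - t.points j‖ ≤ D) (k : ℕ) :
    ∀ t ∈ mesh 𝒯 k, ∀ i j, ‖t.points i - t.points j‖ ≤ D / 2 ^ k := by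
  induction k with
  | zero => simpa [mesh] using hD
  | succ k ih =>
    intro c hc i j
    rw [mesh, Function.iterate_succ_apply'] at hc
    have half : ∀ t ∈ mesh 𝒯 k, ∀ a b, ‖(1 / 2 : ℝ) • (t.points a - t.points b)‖ ≤
        D / 2 ^ (k + 1) := by
      intro t ht a b
      rw [norm_smul, pow_succ, ← div_div]
      have := ih t ht a b
      norm_num
      linarith
    obtain ⟨t, ht, rfl | ⟨l, rfl⟩⟩ := mem_goursat.1 hc
    · have : (centralTri t).points i - (centralTri t).points j =
          (1 / 2 : ℝ) • (t.points j - t.points i) := by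
        fin_cases i <;> fin_cases j <;>
          simp [centralTri, midpoint_eq_smul_add, invOf_eq_inv] <;> module
      rw [this]
      exact half t ht j i
    · have : (cornerTri t l).points i - (cornerTri t l).points j =
          (1 / 2 : ℝ) • (t.points i - t.points j) := by
        simp only [cornerTri, midpoint_eq_smul_add, invOf_eq_inv]
        module
      rw [this]
      exact half t ht i j

lemma norm_points_sub_comb_le {t : Tri} {d : ℝ} (hd : ∀ i j, ‖t.points i - t.points j‖ ≤ d)
    {w : Fin 3 → ℝ} (hw : w ∈ stdSimplex ℝ (Fin 3)) (i : Fin 3) :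
    ‖t.points i - comb t w‖ ≤ d := by
  have : t.points i - comb t w = ∑ j, w j • (t.points i - t.points j) := by
    simp only [smul_sub, Finset.sum_sub_distrib, ← Finset.sum_smul, hw.2, one_smul, comb]
  rw [this]
  refine (norm_sum_le _ _).trans ?_
  calc _ ≤ ∑ j, w j * d := by
        refine Finset.sum_le_sum fun j _ => ?_
        rw [norm_smul, Real.norm_of_nonneg (hw.1 j)]
        exact mul_le_mul_of_nonneg_left (hd i j) (hw.1 j)
    _ = d := by rw [← Finset.sum_mul, hw.2, one_mul]

open Filter Topology

/-! ### Calculus of partial derivatives -/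

lemma contDiff_pderiv {φ : Plane → ℝ} (h : ContDiff ℝ ∞ φ) (i : Fin 2) :
    ContDiff ℝ ∞ (pderiv i φ) :=
  (h.fderiv_right (m := ∞) (by simp)).clm_apply contDiff_const

lemma contDiff_iterate_pderiv {φ : Plane → ℝ} (h : ContDiff ℝ ∞ φ) (i : Fin 2) (n : ℕ) :
    ContDiff ℝ ∞ ((pderiv i)^[n] φ) := by
  induction n with
  | zero => exact h
  | succ n ih => rw [Function.iterate_succ_apply']; exact contDiff_pderiv ih i

lemma hasCompactSupport_pderiv {φ : Plane → ℝ} (h : HasCompactSupport φ) (i : Fin 2) :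
    HasCompactSupport (pderiv i φ) :=
  h.fderiv_apply ℝ _

lemma hasCompactSupport_iterate_pderiv {φ : Plane → ℝ} (h : HasCompactSupport φ) (i : Fin 2)
    (n : ℕ) : HasCompactSupport ((pderiv i)^[n] φ) := by
  induction n with
  | zero => exact h
  | succ n ih => rw [Function.iterate_succ_apply']; exact hasCompactSupport_pderiv ih i

lemma fderiv_apply_eq_sum_pderiv (f : Plane → ℝ) (x v : Plane) :
    fderiv ℝ f x v = ∑ i, v i * pderiv i f x := by
  conv_lhs => rw [← (EuclideanSpace.basisFun (Fin 2) ℝ).sum_repr v]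
  simp [pderiv]

lemma pderiv_comm {φ : Plane → ℝ} (h : ContDiff ℝ ∞ φ) (i j : Fin 2) :
    pderiv i (pderiv j φ) = pderiv j (pderiv i φ) := by
  have key : ∀ i j : Fin 2, ∀ x, pderiv i (pderiv j φ) x =
      fderiv ℝ (fderiv ℝ φ) x (EuclideanSpace.single i 1) (EuclideanSpace.single j 1) := by
    intro i j x
    have hd : DifferentiableAt ℝ (fderiv ℝ φ) x :=
      ((h.fderiv_right (m := ∞) (by simp)).differentiable (by simp)) x
    have : HasFDerivAt (pderiv j φ) _ x :=
      hd.hasFDerivAt.clm_apply (hasFDerivAt_const (EuclideanSpace.single j (1 : ℝ)) x)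
    rw [pderiv, this.fderiv]
    simp
  ext x
  rw [key, key]
  exact (contDiff_infty.1 h 2).contDiffAt.isSymmSndFDerivAt (by simp) _ _

lemma pderiv_const_mul_comp_sub {ψ : Plane → ℝ} (h : ContDiff ℝ ∞ ψ) (i : Fin 2) (c : ℝ)
    (x : Plane) :
    pderiv i (fun y => c * ψ (x - y)) = fun y => -c * pderiv i ψ (x - y) := by
  ext y
  have h1 : HasFDerivAt (fun y => x - y) (-(ContinuousLinearMap.id ℝ Plane)) y := by
    simpa using (hasFDerivAt_id y).const_sub x
  have h2 := (((h.differentiable (by simp)) (x - y)).hasFDerivAt.comp y h1).const_mul c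
  change fderiv ℝ (fun y => c * ψ (x - y)) y _ = _
  rw [show (fun y => c * ψ (x - y)) = fun y => c * (ψ ∘ fun y => x - y) y from rfl, h2.fderiv]
  simp [pderiv]

lemma iterate_pderiv_const_mul_comp_sub {ψ : Plane → ℝ} (h : ContDiff ℝ ∞ ψ) (i : Fin 2) (n : ℕ)
    (c : ℝ) (x : Plane) :
    (pderiv i)^[n] (fun y => c * ψ (x - y)) =
      fun y => (-1) ^ n * c * (pderiv i)^[n] ψ (x - y) := by
  induction n generalizing ψ c with
  | zero => simp
  | succ n ih =>
    rw [Function.iterate_succ_apply, pderiv_const_mul_comp_sub h, ih (contDiff_pderiv h i)]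
    ext y
    rw [Function.iterate_succ_apply]
    ring

lemma mpderiv_comp_sub {ψ : Plane → ℝ} (h : ContDiff ℝ ∞ ψ) (α : Fin 2 → ℕ) (x : Plane) :
    mpderiv α (fun y => ψ (x - y)) = fun y => (-1) ^ mlen α * mpderiv α ψ (x - y) := by
  have h1 := iterate_pderiv_const_mul_comp_sub h 1 (α 1) 1 x
  simp only [one_mul, mul_one] at h1
  rw [mpderiv, h1, iterate_pderiv_const_mul_comp_sub (contDiff_iterate_pderiv h 1 _)]
  ext y
  rw [mlen, pow_add]
  rfl

/-! ### Mollification -/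

/-- Convolution of a kernel `ψ` with a function. -/
noncomputable def mollify (ψ F : Plane → ℝ) : Plane → ℝ :=
  convolution ψ F (ContinuousLinearMap.lsmul ℝ ℝ) volume

lemma mollify_apply (ψ F : Plane → ℝ) (x : Plane) : mollify ψ F x = ∫ y, ψ (x - y) * F y :=
  convolution_lsmul_swap

lemma contDiff_mollify {ψ F : Plane → ℝ} (h : ContDiff ℝ ∞ ψ) (hc : HasCompactSupport ψ)
    (hF : LocallyIntegrable F) : ContDiff ℝ ∞ (mollify ψ F) :=
  hc.contDiff_convolution_left _ h hF

lemma pderiv_mollify {ψ F : Plane → ℝ} (h : ContDiff ℝ ∞ ψ) (hc : HasCompactSupport ψ)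
    (hF : LocallyIntegrable F) (i : Fin 2) :
    pderiv i (mollify ψ F) = mollify (pderiv i ψ) F := by
  ext x
  have h1 : ContDiff ℝ 1 ψ := h.of_le (by simp)
  have := hc.hasFDerivAt_convolution_left (ContinuousLinearMap.lsmul ℝ ℝ) h1 hF x
  rw [pderiv, mollify, this.fderiv, convolution_def, ContinuousLinearMap.integral_apply]
  · rfl
  · exact (hc.fderiv ℝ).convolutionExists_left _ (h1.continuous_fderiv one_ne_zero) hF x

lemma iterate_pderiv_mollify {ψ F : Plane → ℝ} (h : ContDiff ℝ ∞ ψ) (hc : HasCompactSupport ψ)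
    (hF : LocallyIntegrable F) (i : Fin 2) (n : ℕ) :
    (pderiv i)^[n] (mollify ψ F) = mollify ((pderiv i)^[n] ψ) F := by
  induction n with
  | zero => rfl
  | succ n ih =>
    rw [Function.iterate_succ_apply', ih, Function.iterate_succ_apply',
      pderiv_mollify (contDiff_iterate_pderiv h i n) (hasCompactSupport_iterate_pderiv hc i n) hF]

lemma mpderiv_mollify {ψ F : Plane → ℝ} (h : ContDiff ℝ ∞ ψ) (hc : HasCompactSupport ψ)
    (hF : LocallyIntegrable F) (α : Fin 2 → ℕ) :
    mpderiv α (mollify ψ F) = mollify (mpderiv α ψ) F := by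
  rw [mpderiv, iterate_pderiv_mollify h hc hF, iterate_pderiv_mollify
    (contDiff_iterate_pderiv h _ _) (hasCompactSupport_iterate_pderiv hc _ _) hF]
  rfl

/-- Mollification preserves bounds of weak derivatives away from the boundary. -/
lemma abs_mpderiv_mollify_le {Ω : Set Plane} (hΩ : IsOpen Ω) {α : Fin 2 → ℕ} {ρ g : Plane → ℝ}
    (hF : LocallyIntegrable (Ω.indicator ρ)) (hg : IsWeakDeriv Ω α ρ g) {K : ℝ}
    (hK : ∀ᵐ y ∂volume.restrict Ω, |g y| ≤ K) {ψ : Plane → ℝ} (h : ContDiff ℝ ∞ ψ)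
    (hc : HasCompactSupport ψ) (h0 : ∀ y, 0 ≤ ψ y) (h1 : ∫ y, ψ y = 1) {r : ℝ}
    (hr : tsupport ψ ⊆ Metric.closedBall 0 r) {x : Plane} (hx : Metric.closedBall x r ⊆ Ω) :
    |mpderiv α (mollify ψ (Ω.indicator ρ)) x| ≤ K := by
  -- The reflected kernel is an admissible test function, as its support lies in the ball around
  -- `x`. The derivative of the mollification at `x` is thus an average of `g`; the sign from the
  -- reflection cancels the one from the weak derivative.
  let φ : Plane → ℝ := fun y => ψ (x - y)
  have hφs : tsupport φ ⊆ Metric.closedBall x r := by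
    refine closure_minimal (fun y hy => ?_) Metric.isClosed_closedBall
    have : x - y ∈ tsupport ψ := subset_tsupport _ hy
    have := hr this
    rwa [mem_closedBall_zero_iff, ← dist_eq_norm, dist_comm] at this
  have hφc : HasCompactSupport φ := HasCompactSupport.of_support_subset_isCompact
    (isCompact_closedBall x r) ((subset_tsupport _).trans hφs)
  have hφd : ContDiff ℝ ∞ φ := h.comp (contDiff_const.sub contDiff_id)
  have hw := hg.2.2 φ hφd hφc (hφs.trans hx)
  have e1 : mpderiv α (mollify ψ (Ω.indicator ρ)) x = ∫ y in Ω, g y * φ y := by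
    rw [mpderiv_mollify h hc hF, mollify_apply]
    have e2 : ∫ y, mpderiv α ψ (x - y) * Ω.indicator ρ y =
        (-1) ^ mlen α * ∫ y in Ω, ρ y * mpderiv α φ y := by
      rw [← integral_const_mul, ← integral_indicator hΩ.measurableSet]
      refine integral_congr_ae (.of_forall fun y => ?_)
      by_cases hy : y ∈ Ω
      · simp only [hy, indicator_of_mem]
        rw [mpderiv_comp_sub h]
        have : ((-1 : ℝ) ^ mlen α) * (-1) ^ mlen α = 1 := by
          rw [← mul_pow]; simp
        linear_combination (-(mpderiv α ψ (x - y) * ρ y)) * this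
      · simp [hy]
    rw [e2, hw, ← mul_assoc, ← mul_pow]
    simp
  have hint : Integrable φ := hφd.continuous.integrable_of_hasCompactSupport hφc
  have hφ1 : ∫ y in Ω, φ y = 1 := by
    rw [setIntegral_eq_integral_of_forall_compl_eq_zero, ← h1]
    · exact integral_sub_left_eq_self ψ volume x
    · intro y hy
      exact image_eq_zero_of_notMem_tsupport fun h' => hy (hx (hφs h'))
  rw [e1, ← Real.norm_eq_abs]
  refine (norm_integral_le_of_norm_le (g := fun y => K * φ y) (hint.restrict.const_mul K)
    ?_).trans ?_
  · filter_upwards [hK] with y hy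
    rw [norm_mul, Real.norm_eq_abs, Real.norm_of_nonneg (h0 _)]
    exact mul_le_mul_of_nonneg_right hy (h0 _)
  · rw [integral_const_mul, hφ1, mul_one]

/-! ### Uniqueness of weak derivatives -/

lemma integrable_mul_of_tsupport_subset {Ω : Set Plane} {g φ : Plane → ℝ}
    (hg : LocallyIntegrableOn g Ω) (hφ : Continuous φ) (hc : HasCompactSupport φ)
    (hs : tsupport φ ⊆ Ω) : Integrable fun x => g x * φ x := by
  have h1 : IntegrableOn (fun x => g x * φ x) (tsupport φ) :=
    (hg.integrableOn_compact_subset hs hc).mul_continuousOn hφ.continuousOn hc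
  refine (integrableOn_iff_integrable_of_support_subset ?_).1 h1
  exact (Function.support_mul_subset_right _ _).trans (subset_tsupport _)

/-- The fundamental lemma of the calculus of variations. The smaller set `U` allows weak derivatives
to be identified on the interior of a single triangle. -/
lemma ae_eq_of_forall_integral_test {Ω U : Set Plane} (hU : IsOpen U) (hUΩ : U ⊆ Ω)
    {f g : Plane → ℝ} (hf : LocallyIntegrableOn f U) (hg : LocallyIntegrableOn g U)
    (h : ∀ φ : Plane → ℝ, ContDiff ℝ ∞ φ → HasCompactSupport φ → tsupport φ ⊆ U →
      ∫ x in Ω, f x * φ x = ∫ x in Ω, g x * φ x) :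
    ∀ᵐ x, x ∈ U → f x = g x := by
  have key := hU.ae_eq_zero_of_integral_contDiff_smul_eq_zero (μ := volume) (hf.sub hg)
    fun φ hφ hc hs => by
      have hz : ∀ f : Plane → ℝ, ∫ x in Ω, f x * φ x = ∫ x, f x * φ x := fun f =>
        setIntegral_eq_integral_of_forall_compl_eq_zero fun x hx => by
          rw [image_eq_zero_of_notMem_tsupport fun h' => hx (hUΩ (hs h')), mul_zero]
      have := h φ hφ hc hs
      rw [hz, hz, ← sub_eq_zero, ← integral_sub
        (integrable_mul_of_tsupport_subset hf hφ.continuous hc hs)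
        (integrable_mul_of_tsupport_subset hg hφ.continuous hc hs)] at this
      rw [← this]
      refine integral_congr_ae (.of_forall fun x => ?_)
      simp only [Pi.sub_apply, smul_eq_mul]
      ring
  filter_upwards [key] with x hx hxU
  simpa [sub_eq_zero] using hx hxU

lemma IsWeakDeriv.ae_eq {Ω : Set Plane} (hΩ : IsOpen Ω) {α : Fin 2 → ℕ} {f g g' : Plane → ℝ}
    (h : IsWeakDeriv Ω α f g) (h' : IsWeakDeriv Ω α f g') : g =ᵐ[volume.restrict Ω] g' := by
  rw [Filter.EventuallyEq, ae_restrict_iff' hΩ.measurableSet]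
  refine ae_eq_of_forall_integral_test hΩ subset_rfl h.2.1 h'.2.1 fun φ hφ hc hs => ?_
  have := (h.2.2 φ hφ hc hs).symm.trans (h'.2.2 φ hφ hc hs)
  exact mul_left_cancel₀ (by simp) this

lemma IsWeakDeriv.weakDerivNorm_eq {Ω : Set Plane} (hΩ : IsOpen Ω) {α : Fin 2 → ℕ}
    {f g : Plane → ℝ} (h : IsWeakDeriv Ω α f g) (p : ℝ≥0∞) :
    weakDerivNorm Ω α p f = eLpNorm g p (volume.restrict Ω) :=
  le_antisymm (iInf₂_le g h) (le_iInf₂ fun _ h' => (eLpNorm_congr_ae (h.ae_eq hΩ h')).le)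

/-- On an open set where `u` is affine, a weak derivative of `u` is the classical one. -/
lemma IsWeakDeriv.ae_eq_pderiv_of_eqOn_affine {Ω U : Set Plane} (hU : IsOpen U) (hUΩ : U ⊆ Ω)
    {i : Fin 2} {u g : Plane → ℝ} (h : IsWeakDeriv Ω (Pi.single i 1) u g) {A : Plane →ᵃ[ℝ] ℝ}
    (hA : EqOn u A U) : ∀ᵐ x, x ∈ U → g x = pderiv i u x := by
  have hAc : ContDiff ℝ ∞ A :=
    (⟨A, A.continuous_of_finiteDimensional⟩ : Plane →ᴬ[ℝ] ℝ).contDiff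
  have hpA : ∀ x ∈ U, pderiv i u x = pderiv i A x := fun x hx => by
    rw [pderiv, pderiv, (hA.eventuallyEq_of_mem (hU.mem_nhds hx)).fderiv_eq]
  have key : ∀ᵐ x, x ∈ U → g x = pderiv i A x := by
    refine ae_eq_of_forall_integral_test hU hUΩ (h.2.1.mono_set hUΩ)
      ((contDiff_pderiv hAc i).continuous.locallyIntegrable.locallyIntegrableOn U)
      fun φ hφ hc hs => ?_
    have hw := h.2.2 φ hφ hc (hs.trans hUΩ)
    have hm : mpderiv (Pi.single i 1) φ = pderiv i φ := by
      fin_cases i <;> simp [mpderiv]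
    have hl : mlen (Pi.single i 1) = 1 := by fin_cases i <;> simp [mlen]
    have hz : ∀ f φ' : Plane → ℝ, tsupport φ' ⊆ tsupport φ →
        ∫ x in Ω, f x * φ' x = ∫ x, f x * φ' x := fun f φ' h' =>
      setIntegral_eq_integral_of_forall_compl_eq_zero fun x hx => by
        rw [image_eq_zero_of_notMem_tsupport fun h'' => hx (hUΩ (hs (h' h''))), mul_zero]
    have hs' : tsupport (pderiv i φ) ⊆ tsupport φ := tsupport_fderiv_apply_subset ℝ _
    rw [hm, hl, hz _ _ hs', pow_one, neg_one_mul] at hw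
    rw [hz _ _ subset_rfl] at hw ⊢
    rw [hz _ _ subset_rfl]
    have e1 : ∫ x, u x * pderiv i φ x = ∫ x, A x * pderiv i φ x := by
      refine integral_congr_ae (.of_forall fun x => ?_)
      by_cases hx : x ∈ tsupport φ
      · simp only [hA (hs hx)]
      · simp [image_eq_zero_of_notMem_tsupport fun h'' => hx (hs' h'')]
    have hint : ∀ f φ' : Plane → ℝ, Continuous f → Continuous φ' → HasCompactSupport φ' →
        Integrable fun x => f x * φ' x := fun f φ' hf hφ' hc' =>
      (hf.mul hφ').integrable_of_hasCompactSupport hc'.mul_left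
    have e2 : ∫ x, A x * pderiv i φ x = -∫ x, pderiv i A x * φ x := by
      refine integral_mul_fderiv_eq_neg_fderiv_mul_of_integrable ?_ ?_ ?_
        (fun x _ => hAc.differentiable (by simp) x) (fun x _ => hφ.differentiable (by simp) x)
      · exact hint (pderiv i A) φ (contDiff_pderiv hAc i).continuous hφ.continuous hc
      · exact hint A (pderiv i φ) hAc.continuous (contDiff_pderiv hφ i).continuous
          (hasCompactSupport_pderiv hc i)
      · exact hint A φ hAc.continuous hφ.continuous hc
    linarith
  filter_upwards [key] with x hx hxU
  rw [hx hxU, hpA x hxU]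

/-! ### Taylor estimates -/

lemma abs_coord_le (v : Plane) (i : Fin 2) : |v i| ≤ ‖v‖ := by
  simpa using PiLp.norm_apply_le v i

lemma norm_le_of_abs_pderiv_le {L : Plane →L[ℝ] ℝ} {K : ℝ}
    (h : ∀ i, |L (EuclideanSpace.single i 1)| ≤ K) : ‖L‖ ≤ 2 * K := by
  have hK : 0 ≤ K := (abs_nonneg _).trans (h 0)
  refine L.opNorm_le_bound (by positivity) fun v => ?_
  have : L v = ∑ i, v i * L (EuclideanSpace.single i 1) := by
    conv_lhs => rw [← (EuclideanSpace.basisFun (Fin 2) ℝ).sum_repr v]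
    simp
  rw [this, Fin.sum_univ_two, Real.norm_eq_abs]
  refine (abs_add_le _ _).trans ?_
  rw [abs_mul, abs_mul]
  have h0 := mul_le_mul (abs_coord_le v 0) (h 0) (abs_nonneg _) (norm_nonneg _)
  have h1 := mul_le_mul (abs_coord_le v 1) (h 1) (abs_nonneg _) (norm_nonneg _)
  linarith

/-- The mean value inequality for each `pderiv i f`, whose gradient is at most `2 * K`; passing from
coordinates to the operator norm costs another factor 2. -/
lemma norm_fderiv_sub_le {f : Plane → ℝ} (hf : ContDiff ℝ ∞ f) {s : Set Plane} (hs : Convex ℝ s)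
    {K : ℝ} (h2 : ∀ x ∈ s, ∀ i j, |pderiv i (pderiv j f) x| ≤ K) {x y : Plane} (hx : x ∈ s)
    (hy : y ∈ s) : ‖fderiv ℝ f y - fderiv ℝ f x‖ ≤ 4 * K * ‖y - x‖ := by
  refine (norm_le_of_abs_pderiv_le (K := 2 * K * ‖y - x‖) fun i => ?_).trans_eq (by ring)
  exact hs.norm_image_sub_le_of_norm_fderiv_le
    (fun z _ => (contDiff_pderiv hf i).differentiable (by simp) z)
    (fun z hz => norm_le_of_abs_pderiv_le fun j => h2 z hz j i) hx hy

/-- The mean value inequality on the segment for `f` minus its linearization at `x`. -/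
lemma abs_taylor_remainder_le {f : Plane → ℝ} (hf : ContDiff ℝ ∞ f) {s : Set Plane}
    (hs : Convex ℝ s) {K : ℝ} (h2 : ∀ x ∈ s, ∀ i j, |pderiv i (pderiv j f) x| ≤ K) {x y : Plane}
    (hx : x ∈ s) (hy : y ∈ s) :
    |f y - f x - fderiv ℝ f x (y - x)| ≤ 4 * K * ‖y - x‖ ^ 2 := by
  have hK : 0 ≤ K := (abs_nonneg _).trans (h2 x hx 0 0)
  have hseg := hs.segment_subset hx hy
  have := (convex_segment x y).norm_image_sub_le_of_norm_fderiv_le' (𝕜 := ℝ) (f := f)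
    (φ := fderiv ℝ f x) (C := 4 * K * ‖y - x‖)
    (fun z _ => hf.differentiable (by simp) z) (fun z hz => ?_) (left_mem_segment ℝ x y)
    (right_mem_segment ℝ x y)
  · rw [Real.norm_eq_abs] at this
    linarith
  · refine (norm_fderiv_sub_le hf hs h2 hx (hseg hz)).trans ?_
    obtain ⟨θ, hθ, rfl⟩ := segment_eq_image' ℝ x y ▸ hz
    refine mul_le_mul_of_nonneg_left ?_ (by positivity)
    rw [add_sub_cancel_left, norm_smul, Real.norm_of_nonneg hθ.1]
    exact mul_le_of_le_one_left (norm_nonneg _) hθ.2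

/-- The error of the discrete multiplication for a smooth coefficient: `x` is the combination of
the nodes `Q i` with weights `w i`, and `a i` are the nodal values of an affine function. -/
lemma abs_sum_mul_sub_le {f : Plane → ℝ} (hf : ContDiff ℝ ∞ f) {s : Set Plane} (hs : Convex ℝ s)
    {K : ℝ} (h1 : ∀ x ∈ s, ∀ i, |pderiv i f x| ≤ K)
    (h2 : ∀ x ∈ s, ∀ i j, |pderiv i (pderiv j f) x| ≤ K) {Q : Fin 3 → Plane}
    (hQ : ∀ i, Q i ∈ s) {w : Fin 3 → ℝ} (hw : w ∈ stdSimplex ℝ (Fin 3)) {a : Fin 3 → ℝ}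
    {b d δ : ℝ} (hd : ∀ i, ‖Q i - ∑ j, w j • Q j‖ ≤ d) (hδ : ∀ i, |a i - b| ≤ δ) :
    |∑ i, w i * (a i * (f (Q i) - f (∑ j, w j • Q j)))| ≤
      K * (2 * δ * d + 4 * (|b| + δ) * d ^ 2) := by
  set x := ∑ j, w j • Q j with hx
  have hxs : x ∈ s := hs.sum_mem (fun i _ => hw.1 i) hw.2 fun i _ => hQ i
  have hK : 0 ≤ K := (abs_nonneg _).trans (h1 x hxs 0)
  have hd0 : 0 ≤ d := (norm_nonneg _).trans (hd 0)
  have hδ0 : 0 ≤ δ := (abs_nonneg _).trans (hδ 0)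
  have hL : ‖fderiv ℝ f x‖ ≤ 2 * K := norm_le_of_abs_pderiv_le fun i => h1 x hxs i
  -- The cancellation that yields second order: `x` is the weighted mean of the nodes, so the linear
  -- term averages out when its factor is the constant `b`.
  have hzero : ∑ i, w i * fderiv ℝ f x (Q i - x) = 0 := by
    have : ∑ i, w i • (Q i - x) = 0 := by
      simp only [smul_sub, Finset.sum_sub_distrib, ← Finset.sum_smul, hw.2, one_smul, ← hx,
        sub_self]
    simpa using congrArg (fderiv ℝ f x) this
  have e : ∑ i, w i * (a i * (f (Q i) - f x)) = ∑ i, w i * ((a i - b) * fderiv ℝ f x (Q i - x) +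
      a i * (f (Q i) - f x - fderiv ℝ f x (Q i - x))) := by
    have : ∑ i, w i * (a i * (f (Q i) - f x)) =
        ∑ i, w i * (a i * (f (Q i) - f x)) - b * ∑ i, w i * fderiv ℝ f x (Q i - x) := by
      rw [hzero, mul_zero, sub_zero]
    rw [this, Finset.mul_sum, ← Finset.sum_sub_distrib]
    exact Finset.sum_congr rfl fun i _ => by ring
  rw [e]
  refine (Finset.abs_sum_le_sum_abs _ _).trans ?_
  have : ∀ i, |w i * ((a i - b) * fderiv ℝ f x (Q i - x) +
      a i * (f (Q i) - f x - fderiv ℝ f x (Q i - x)))| ≤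
      w i * (K * (2 * δ * d + 4 * (|b| + δ) * d ^ 2)) := by
    intro i
    rw [abs_mul, abs_of_nonneg (hw.1 i)]
    refine mul_le_mul_of_nonneg_left ((abs_add_le _ _).trans ?_) (hw.1 i)
    rw [abs_mul, abs_mul]
    have t1 : |fderiv ℝ f x (Q i - x)| ≤ 2 * K * d :=
      ((fderiv ℝ f x).le_opNorm _).trans
        (mul_le_mul hL (hd i) (norm_nonneg _) (by positivity))
    have t2 : |f (Q i) - f x - fderiv ℝ f x (Q i - x)| ≤ 4 * K * d ^ 2 :=
      (abs_taylor_remainder_le hf hs h2 hxs (hQ i)).trans (by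
        have := hd i
        gcongr)
    have t3 : |a i| ≤ |b| + δ := by
      have := abs_add_le b (a i - b)
      rw [add_sub_cancel] at this
      linarith [hδ i]
    have t4 := mul_le_mul (hδ i) t1 (abs_nonneg _) hδ0
    have t5 := mul_le_mul t3 t2 (abs_nonneg _) (by positivity)
    linarith
  refine (Finset.sum_le_sum fun i _ => this i).trans ?_
  rw [← Finset.sum_mul, hw.2, one_mul]

/-! ### Smooth approximation of `W²_∞` functions -/

/-- A sequence of smooth functions that converges to `ρ` almost everywhere in `Ω` and whose first
and second derivatives are eventually bounded by `K` on each compact subset of `Ω`. -/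
structure SmoothApprox (Ω : Set Plane) (K : ℝ) (ρ : Plane → ℝ) (f : ℕ → Plane → ℝ) : Prop where
  contDiff : ∀ n, ContDiff ℝ ∞ (f n)
  bound₁ : ∀ S ⊆ Ω, IsCompact S → ∀ᶠ n in atTop, ∀ x ∈ S, ∀ i, |pderiv i (f n) x| ≤ K
  bound₂ : ∀ S ⊆ Ω, IsCompact S →
    ∀ᶠ n in atTop, ∀ x ∈ S, ∀ i j, |pderiv i (pderiv j (f n)) x| ≤ K
  tendsto : ∀ᵐ x, x ∈ Ω → Tendsto (fun n => f n x) atTop (𝓝 (ρ x))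

lemma weakDerivNorm_le_W2infQuotNorm {Ω : Set Plane} {α : Fin 2 → ℕ} (h1 : 1 ≤ mlen α)
    (h2 : mlen α ≤ 2) (ρ : Plane → ℝ) : weakDerivNorm Ω α ∞ ρ ≤ W2infQuotNorm Ω ρ :=
  le_iSup₂ (f := fun (α : Fin 2 → ℕ) (_ : 1 ≤ mlen α ∧ mlen α ≤ 2) => weakDerivNorm Ω α ∞ ρ)
    α ⟨h1, h2⟩

/-- Only finitely many multi-indices have length at most 2, so a finite sum of finite norms
dominates the supremum. -/
lemma MemSobolev.W2infQuotNorm_lt_top {Ω : Set Plane} {ρ : Plane → ℝ}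
    (hρ : MemSobolev Ω 2 ∞ ρ) : W2infQuotNorm Ω ρ < ⊤ := by
  let s : Finset (Fin 2 → ℕ) :=
    (Fintype.piFinset fun _ => Finset.range 3).filter fun α => mlen α ≤ 2
  have hle : W2infQuotNorm Ω ρ ≤ ∑ α ∈ s, weakDerivNorm Ω α ∞ ρ := by
    refine iSup₂_le fun α hα => Finset.single_le_sum (f := fun α => weakDerivNorm Ω α ∞ ρ)
      (fun _ _ => zero_le) ?_
    have := hα.2
    simp only [s, Finset.mem_filter, Fintype.mem_piFinset, Finset.mem_range, Fin.forall_fin_two]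
    unfold mlen at *
    omega
  refine hle.trans_lt (ENNReal.sum_lt_top.2 fun α hα => ?_)
  obtain ⟨g, hg, hgm⟩ := hρ.2 α (Finset.mem_filter.1 hα).2
  exact (iInf₂_le g hg).trans_lt hgm.2

lemma MemSobolev.exists_smoothApprox {Ω : Set Plane} (hΩ : IsOpen Ω)
    (hb : Bornology.IsBounded Ω) {ρ : Plane → ℝ} (hρ : MemSobolev Ω 2 ∞ ρ) :
    ∃ f, SmoothApprox Ω (W2infQuotNorm Ω ρ).toReal ρ f := by
  set K := (W2infQuotNorm Ω ρ).toReal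
  have hfin : IsFiniteMeasure (volume.restrict Ω) :=
    ⟨by simpa using hb.measure_lt_top⟩
  have hF : LocallyIntegrable (Ω.indicator ρ) :=
    ((integrable_indicator_iff hΩ.measurableSet).2
      (hρ.1.integrable (by simp))).locallyIntegrable
  -- The ratio of outer to inner radius stays equal to 2, as needed for almost everywhere
  -- convergence of the mollifications.
  let φ : ℕ → ContDiffBump (0 : Plane) := fun n =>
    ⟨1 / (n + 1), 2 * (1 / (n + 1)), by positivity, by
      have : (0 : ℝ) < 1 / (n + 1) := by positivity
      linarith⟩
  have hφ : Tendsto (fun n => (φ n).rOut) atTop (𝓝 0) := by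
    simpa [φ] using (tendsto_one_div_add_atTop_nhds_zero_nat (𝕜 := ℝ)).const_mul 2
  let ψ : ℕ → Plane → ℝ := fun n => (φ n).normed volume
  have hψ : ∀ n, ContDiff ℝ ∞ (ψ n) := fun n => (φ n).contDiff_normed
  have hψc : ∀ n, HasCompactSupport (ψ n) := fun n => (φ n).hasCompactSupport_normed
  have hf : ∀ n, ContDiff ℝ ∞ (mollify (ψ n) (Ω.indicator ρ)) := fun n =>
    contDiff_mollify (hψ n) (hψc n) hF
  have hbound : ∀ α : Fin 2 → ℕ, 1 ≤ mlen α → mlen α ≤ 2 → ∀ S ⊆ Ω, IsCompact S →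
      ∀ᶠ n in atTop, ∀ x ∈ S, |mpderiv α (mollify (ψ n) (Ω.indicator ρ)) x| ≤ K := by
    intro α h1 h2 S hS hSc
    obtain ⟨g, hg, -⟩ := hρ.2 α h2
    have hgK : ∀ᵐ y ∂volume.restrict Ω, |g y| ≤ K := by
      filter_upwards [enorm_ae_le_eLpNormEssSup g (volume.restrict Ω)] with y hy
      rw [← eLpNorm_exponent_top, ← hg.weakDerivNorm_eq hΩ] at hy
      have := ENNReal.toReal_mono hρ.W2infQuotNorm_lt_top.ne
        (hy.trans (weakDerivNorm_le_W2infQuotNorm h1 h2 ρ))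
      simpa using this
    -- Kernels of radius at most `δ`, centred in `S`, see only `Ω`, so the extension of `ρ` by zero
    -- does no harm.
    obtain ⟨δ, hδ, hδS⟩ := hSc.exists_cthickening_subset_open hΩ hS
    filter_upwards [hφ.eventually (ge_mem_nhds hδ)] with n hn x hx
    refine abs_mpderiv_mollify_le hΩ hF hg hgK (hψ n) (hψc n) (φ n).nonneg_normed
      (φ n).integral_normed (φ n).tsupport_normed_eq.subset ?_
    exact (Metric.closedBall_subset_closedBall hn).trans
      ((Metric.closedBall_subset_cthickening hx δ).trans hδS)
  refine ⟨fun n => mollify (ψ n) (Ω.indicator ρ), hf, fun S hS hSc => ?_, fun S hS hSc => ?_, ?_⟩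
  · have h : ∀ i : Fin 2, _ := fun i => hbound (Pi.single i 1)
      (by fin_cases i <;> simp [mlen]) (by fin_cases i <;> simp [mlen]) S hS hSc
    filter_upwards [h 0, h 1] with n h0 h1 x hx i
    fin_cases i
    · simpa [mpderiv] using h0 x hx
    · simpa [mpderiv] using h1 x hx
  · filter_upwards [hbound ![2, 0] (by simp [mlen]) (by simp [mlen]) S hS hSc,
      hbound ![1, 1] (by simp [mlen]) (by simp [mlen]) S hS hSc,
      hbound ![0, 2] (by simp [mlen]) (by simp [mlen]) S hS hSc] with n h20 h11 h02 x hx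
    have a := h20 x hx
    have b := h11 x hx
    have c := h02 x hx
    simp only [mpderiv, Matrix.cons_val_zero, Matrix.cons_val_one,
      Function.iterate_succ_apply, Function.iterate_zero_apply] at a b c
    simp only [Fin.forall_fin_two]
    exact ⟨⟨a, b⟩, ⟨by rwa [pderiv_comm (hf n)], c⟩⟩
  · have := ContDiffBump.ae_convolution_tendsto_right_of_locallyIntegrable (φ := φ) (K := 2) hφ
      (.of_forall fun n => le_rfl) hF
    filter_upwards [this] with x hx hxΩ
    rw [indicator_of_mem hxΩ] at hx
    exact hx

/-- Equi-Lipschitz bounds carry convergence from almost every point to every point of `Ω`. -/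
lemma SmoothApprox.eventually_abs_sub_le {Ω : Set Plane} {K : ℝ} {ρ : Plane → ℝ}
    {f : ℕ → Plane → ℝ} (h : SmoothApprox Ω K ρ f) {x : Plane} {r : ℝ}
    (hx : Metric.closedBall x r ⊆ Ω) : ∀ᶠ n in atTop,
      ∀ y ∈ Metric.closedBall x r, ∀ z ∈ Metric.closedBall x r,
        |f n y - f n z| ≤ 2 * K * ‖y - z‖ := by
  filter_upwards [h.bound₁ _ hx (isCompact_closedBall x r)] with n hn y hy z hz
  exact (convex_closedBall x r).norm_image_sub_le_of_norm_fderiv_le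
    (fun p _ => (h.contDiff n).differentiable (by simp) p)
    (fun p hp => norm_le_of_abs_pderiv_le (hn p hp)) hz hy

lemma SmoothApprox.exists_continuousOn {Ω : Set Plane} (hΩ : IsOpen Ω) {K : ℝ} (hK : 0 ≤ K)
    {ρ : Plane → ℝ} {f : ℕ → Plane → ℝ} (h : SmoothApprox Ω K ρ f) :
    ∃ ρc : Plane → ℝ, ContinuousOn ρc Ω ∧ ρc =ᵐ[volume.restrict Ω] ρ ∧
      ∀ x ∈ Ω, Tendsto (fun n => f n x) atTop (𝓝 (ρc x)) := by
  have hcauchy : ∀ x ∈ Ω, CauchySeq fun n => f n x := by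
    intro x hx
    obtain ⟨r, hr, hball⟩ := Metric.nhds_basis_closedBall.mem_iff.1 (hΩ.mem_nhds hx)
    have hlip := h.eventually_abs_sub_le hball
    rw [Metric.cauchySeq_iff]
    intro ε hε
    -- With this radius `2 * K * ‖x - z‖ ≤ ε / 4`; the two Lipschitz errors and the `ε / 2` at `z`
    -- add up to `ε`. The summand 4 covers `K = 0`.
    have hη : 0 < min r (ε / (8 * K + 4)) := by positivity
    obtain ⟨z, hz, hxz⟩ := (Measure.dense_of_ae h.tendsto).exists_dist_lt x hη
    have hzr : z ∈ Metric.closedBall x r := by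
      rw [Metric.mem_closedBall, dist_comm]
      exact hxz.le.trans (min_le_left _ _)
    have hzc := (hz (hball hzr)).cauchySeq
    obtain ⟨N, hN⟩ := (Metric.cauchySeq_iff.1 hzc) (ε / 2) (by positivity)
    obtain ⟨M, hM⟩ := eventually_atTop.1 hlip
    have hd : 2 * K * ‖x - z‖ ≤ ε / 4 := by
      rw [← dist_eq_norm]
      have := hxz.le.trans (min_le_right _ _)
      rw [le_div_iff₀ (by positivity)] at this
      nlinarith [dist_nonneg (x := x) (y := z)]
    have hxr := Metric.mem_closedBall_self (x := x) hr.le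
    refine ⟨max N M, fun m hm n hn => ?_⟩
    have a := hM m (le_of_max_le_right hm) x hxr z hzr
    have b := hM n (le_of_max_le_right hn) x hxr z hzr
    have c := hN m (le_of_max_le_left hm) n (le_of_max_le_left hn)
    rw [Real.dist_eq] at c ⊢
    rw [abs_le] at a b
    rw [abs_lt] at c ⊢
    constructor <;> linarith
  choose! ρc hρc using fun x hx => cauchySeq_tendsto_of_complete (hcauchy x hx)
  refine ⟨ρc, fun x hx => ContinuousAt.continuousWithinAt ?_, ?_, hρc⟩
  · obtain ⟨r, hr, hball⟩ := Metric.nhds_basis_closedBall.mem_iff.1 (hΩ.mem_nhds hx)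
    have hlip := h.eventually_abs_sub_le hball
    have : LipschitzOnWith (2 * K).toNNReal ρc (Metric.closedBall x r) := by
      refine LipschitzOnWith.of_dist_le_mul fun y hy z hz => ?_
      rw [Real.coe_toNNReal _ (by positivity), Real.dist_eq, dist_eq_norm]
      refine le_of_tendsto ((hρc y (hball hy)).sub (hρc z (hball hz))).abs ?_
      filter_upwards [hlip] with n hn
      exact hn y hy z hz
    exact this.continuousOn.continuousAt (Metric.closedBall_mem_nhds x hr)
  · rw [Filter.EventuallyEq, ae_restrict_iff' hΩ.measurableSet]
    filter_upwards [h.tendsto] with x hx hxΩ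
    exact tendsto_nhds_unique (hρc x hxΩ) (hx hxΩ)

/-! ### The pointwise estimate on a triangle -/

/-- The derivative bounds hold only on compact subsets of `Ω`, while vertices may lie on the
boundary. The triangle is therefore shrunk towards `x`: the nodes `Q s i` have the same weighted
mean `x` and a compact hull in `Ω`. As `s → 0`, continuity of `ρc` is needed only at vertices in
`Ω`, since `a i = 0` at the others. -/
lemma SmoothApprox.abs_sum_mul_sub_le {Ω : Set Plane} {K : ℝ} {ρ ρc : Plane → ℝ}
    {f : ℕ → Plane → ℝ} (h : SmoothApprox Ω K ρ f) (hΩ : IsOpen Ω) (hρc : ContinuousOn ρc Ω)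
    (hlim : ∀ x ∈ Ω, Tendsto (fun n => f n x) atTop (𝓝 (ρc x))) {t : Tri}
    (ht : interior t.closedInterior ⊆ Ω) {w : Fin 3 → ℝ} (hw : w ∈ stdSimplex ℝ (Fin 3))
    (hx : comb t w ∈ interior t.closedInterior) {a : Fin 3 → ℝ} {b d δ : ℝ}
    (hd : ∀ i, ‖t.points i - comb t w‖ ≤ d) (hδ : ∀ i, |a i - b| ≤ δ)
    (ha : ∀ i, t.points i ∉ Ω → a i = 0) :
    |∑ i, w i * (a i * (ρc (t.points i) - ρc (comb t w)))| ≤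
      K * (2 * δ * d + 4 * (|b| + δ) * d ^ 2) := by
  set x := comb t w with hxdef
  let Q : ℝ → Fin 3 → Plane := fun s i => (1 - s) • t.points i + s • x
  have hconv : Convex ℝ t.closedInterior := by
    rw [← t.convexHull_eq_closedInterior]
    exact convex_convexHull ℝ _
  have hQx : ∀ s, ∑ i, w i • Q s i = x := by
    intro s
    have : ∑ i, w i • Q s i = (1 - s) • comb t w + s • ((∑ i, w i) • x) := by
      simp only [Q, comb, smul_add, Finset.sum_add_distrib, Finset.smul_sum, Finset.sum_smul]
      congr 1 <;> exact Finset.sum_congr rfl fun i _ => smul_comm _ _ _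
    rw [this, hw.2, ← hxdef]
    module
  have step : ∀ s ∈ Ioo (0 : ℝ) 1, |∑ i, w i * (a i * (ρc (Q s i) - ρc x))| ≤
      K * (2 * δ * d + 4 * (|b| + δ) * d ^ 2) := by
    intro s hs
    have hQ : ∀ i, Q s i ∈ interior t.closedInterior := fun i =>
      hconv.combo_self_interior_mem_interior (t.point_mem_closedInterior i) hx
        (by linarith [hs.2]) hs.1 (by ring)
    have hS : convexHull ℝ (range (Q s)) ⊆ Ω :=
      (convexHull_min (range_subset_iff.2 hQ) hconv.interior).trans ht
    have hSc : IsCompact (convexHull ℝ (range (Q s))) :=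
      (finite_range _).isCompact_convexHull ℝ
    refine le_of_tendsto (f := fun n => |∑ i, w i * (a i * (f n (Q s i) - f n x))|)
      (tendsto_finsetSum _ fun i _ => (((hlim _ (ht (hQ i))).sub
        (hlim _ (ht hx))).const_mul _).const_mul _).abs ?_
    filter_upwards [h.bound₁ _ hS hSc, h.bound₂ _ hS hSc] with n h1 h2
    have key := P1FEM.abs_sum_mul_sub_le (h.contDiff n) (convex_convexHull ℝ _) h1 h2
      (fun i => subset_convexHull ℝ _ (mem_range_self i)) hw (d := d) (fun i => ?_) hδ
    · rwa [hQx] at key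
    · rw [hQx, show Q s i - x = (1 - s) • (t.points i - x) by simp only [Q]; module, norm_smul,
        Real.norm_of_nonneg (by linarith [hs.2])]
      exact (mul_le_of_le_one_left (norm_nonneg _) (by linarith [hs.1])).trans (hd i)
  have hev : ∀ᶠ s in 𝓝[>] (0 : ℝ), s ∈ Ioo (0 : ℝ) 1 := Ioo_mem_nhdsGT one_pos
  refine le_of_tendsto (tendsto_finsetSum _ fun i _ => Tendsto.const_mul _ ?_).abs
    (hev.mono step)
  by_cases hi : t.points i ∈ Ω
  · refine Tendsto.const_mul _ (Tendsto.sub_const ?_ _)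
    have hc : Continuous fun s => Q s i := by fun_prop
    have h0 : Tendsto (fun s => Q s i) (𝓝[>] 0) (𝓝 (t.points i)) := by
      refine (hc.tendsto' 0 _ ?_).mono_left nhdsWithin_le_nhds
      simp [Q]
    exact (hρc.continuousAt (hΩ.mem_nhds hi)).tendsto.comp h0
  · simp [ha i hi]

/-- The error of the discrete multiplication operator at interior points of the triangles. -/
lemma SmoothApprox.abs_mulOp_sub_discMulOp_le {Ω : Set Plane} {K : ℝ} {ρ ρc : Plane → ℝ}
    {f : ℕ → Plane → ℝ} (h : SmoothApprox Ω K ρ f) (hΩ : IsOpen Ω) (hρc : ContinuousOn ρc Ω)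
    (hlim : ∀ x ∈ Ω, Tendsto (fun n => f n x) atTop (𝓝 (ρc x))) {𝒯 : Finset Tri}
    (h𝒯 : Consistent 𝒯) {u : Plane → ℝ} (hu : u ∈ FESpace Ω 𝒯) {t : Tri} (ht : t ∈ 𝒯)
    (hint : interior t.closedInterior ⊆ Ω) (hcl : t.closedInterior ⊆ closure Ω) {d : ℝ}
    (hd : ∀ i j, ‖t.points i - t.points j‖ ≤ d) {x : Plane}
    (hx : x ∈ interior t.closedInterior) :
    |ρc x * u x - discMulOp Ω 𝒯 (interp Ω 𝒯 ρc) u x| ≤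
      K * (2 * ((|pderiv 0 u x| + |pderiv 1 u x|) * d) * d +
        4 * (|u x| + (|pderiv 0 u x| + |pderiv 1 u x|) * d) * d ^ 2) := by
  classical
  obtain ⟨w, hw, rfl⟩ := mem_closedInterior_iff_comb.1 (interior_subset hx)
  obtain ⟨A, hA⟩ := hu.2.1 t ht
  have hpt : ∀ i, t.points i ∈ t.closedInterior := t.point_mem_closedInterior
  have hzero : ∀ i, t.points i ∉ Ω → u (t.points i) = 0 := fun i hi =>
    hu.2.2 _ ⟨hcl (hpt i), fun h' => hi (interior_subset h')⟩
  have hux : u (comb t w) = ∑ i, w i * u (t.points i) := by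
    rw [hA (interior_subset hx), map_comb A t hw.2]
    exact Finset.sum_congr rfl fun i _ => by rw [hA (hpt i)]
  -- The inner interpolation is invisible: only its values at nodes in `Ω` enter, where it equals
  -- `ρc`. Boundary nodes drop out with `u`.
  have hdisc : discMulOp Ω 𝒯 (interp Ω 𝒯 ρc) u (comb t w) =
      ∑ i, w i * (u (t.points i) * ρc (t.points i)) := by
    rw [discMulOp, h𝒯.interp_comb Ω _ ht hw]
    refine Finset.sum_congr rfl fun i _ => ?_
    split_ifs with hi
    · rw [mulOp, h𝒯.interp_points ρc ht hi, mul_comm (ρc _)]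
    · rw [hzero i hi, zero_mul]
  have hd' := norm_points_sub_comb_le hd hw
  have hfd : fderiv ℝ u (comb t w) = A.linear.toContinuousLinearMap := by
    rw [((hA.mono interior_subset).eventuallyEq_of_mem
      (isOpen_interior.mem_nhds hx)).fderiv_eq]
    exact (⟨A, A.continuous_of_finiteDimensional⟩ : Plane →ᴬ[ℝ] ℝ).hasFDerivAt.fderiv
  have hδ : ∀ i, |u (t.points i) - u (comb t w)| ≤
      (|pderiv 0 u (comb t w)| + |pderiv 1 u (comb t w)|) * d := by
    intro i
    have e : u (t.points i) - u (comb t w) =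
        fderiv ℝ u (comb t w) (t.points i - comb t w) := by
      rw [hA (hpt i), hA (interior_subset hx), hfd]
      exact (A.linearMap_vsub _ _).symm
    rw [e, fderiv_apply_eq_sum_pderiv, Fin.sum_univ_two]
    refine (abs_add_le _ _).trans ?_
    rw [abs_mul, abs_mul]
    have h0 := mul_le_mul_of_nonneg_right ((abs_coord_le _ 0).trans (hd' i))
      (abs_nonneg (pderiv 0 u (comb t w)))
    have h1 := mul_le_mul_of_nonneg_right ((abs_coord_le _ 1).trans (hd' i))
      (abs_nonneg (pderiv 1 u (comb t w)))
    linarith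
  have key := h.abs_sum_mul_sub_le hΩ hρc hlim hint hw hx hd' hδ hzero
  rw [abs_sub_comm, hdisc]
  convert key using 2
  rw [hux, Finset.mul_sum, ← Finset.sum_sub_distrib]
  exact Finset.sum_congr rfl fun i _ => by ring

/-! ### Integration -/

lemma IsTriangulation.ae_mem_interior {𝒯 : Finset Tri} {Ω : Set Plane}
    (h : IsTriangulation 𝒯 Ω) (k : ℕ) :
    ∀ᵐ x, x ∈ Ω → ∃ t ∈ mesh 𝒯 k, x ∈ interior t.closedInterior := by
  have : ∀ᵐ x : Plane, ∀ t ∈ mesh 𝒯 k, x ∉ frontier t.closedInterior := by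
    rw [Filter.eventually_all_finset]
    intro t _
    refine measure_eq_zero_iff_ae_notMem.1 (Convex.addHaar_frontier volume ?_)
    rw [← t.convexHull_eq_closedInterior]
    exact convex_convexHull ℝ _
  filter_upwards [this] with x hx hxΩ
  obtain ⟨t, ht, hxt⟩ := h.cover_mesh k (subset_closure hxΩ)
  exact ⟨t, ht, by_contra fun h' => hx t ht ⟨subset_closure hxt, h'⟩⟩

/-- Every weak derivative agrees with the classical one inside each triangle, hence almost
everywhere. If none exists, the right side is `∞`, so membership of `u` in `H¹` need not be shown.
-/
lemma IsTriangulation.L2Norm_pderiv_le {𝒯 : Finset Tri} {Ω : Set Plane}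
    (h : IsTriangulation 𝒯 Ω) (hΩ : IsOpen Ω) {k : ℕ} {u : Plane → ℝ}
    (hu : u ∈ FESpace Ω (mesh 𝒯 k)) (i : Fin 2) :
    L2Norm Ω (pderiv i u) ≤ weakDerivNorm Ω (Pi.single i 1) 2 u := by
  refine le_iInf₂ fun g hg => (eLpNorm_congr_ae ?_).le
  rw [Filter.EventuallyEq, ae_restrict_iff' hΩ.measurableSet]
  have : ∀ᵐ x : Plane, ∀ t ∈ mesh 𝒯 k, x ∈ interior t.closedInterior → g x = pderiv i u x := by
    rw [Filter.eventually_all_finset]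
    intro t ht
    obtain ⟨A, hA⟩ := hu.2.1 t ht
    exact hg.ae_eq_pderiv_of_eqOn_affine isOpen_interior (h.interior_subset_domain ht)
      (hA.mono interior_subset)
  filter_upwards [this, h.ae_mem_interior k] with x hx hx' hxΩ
  obtain ⟨t, ht, hxt⟩ := hx' hxΩ
  exact (hx t ht hxt).symm

lemma le_rpow_half_of_sq_le {a b : ℝ≥0∞} (h : a ^ 2 ≤ b) : a ≤ b ^ (1 / 2 : ℝ) := by
  calc a = (a ^ 2) ^ (1 / 2 : ℝ) := by
        rw [← ENNReal.rpow_natCast, ← ENNReal.rpow_mul]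
        norm_num
    _ ≤ b ^ (1 / 2 : ℝ) := ENNReal.rpow_le_rpow h (by norm_num)

/-- The factor 3 counts the terms of the triangle inequality, each of norm at most `H1Norm Ω u`. -/
lemma L2Norm_le_mul_H1Norm {Ω : Set Plane} {u f : Plane → ℝ} {c : ℝ}
    (hu : AEStronglyMeasurable u (volume.restrict Ω))
    (hp : ∀ i, L2Norm Ω (pderiv i u) ≤ weakDerivNorm Ω (Pi.single i 1) 2 u)
    (hf : ∀ᵐ x ∂volume.restrict Ω, |f x| ≤ c * (|u x| + |pderiv 0 u x| + |pderiv 1 u x|)) :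
    L2Norm Ω f ≤ ENNReal.ofReal c * (3 * H1Norm Ω u) := by
  have hm : ∀ i, AEStronglyMeasurable (fun x => |pderiv i u x|) (volume.restrict Ω) := fun i =>
    (measurable_fderiv_apply_const ℝ u _).aestronglyMeasurable.norm
  have hu' : L2Norm Ω u ≤ H1Norm Ω u := le_rpow_half_of_sq_le le_self_add
  have hp' : ∀ i, L2Norm Ω (pderiv i u) ≤ H1Norm Ω u := fun i => by
    refine le_rpow_half_of_sq_le ((pow_le_pow_left' (hp i) 2).trans ?_)
    refine le_add_left ?_
    exact Finset.single_le_sum (f := fun i => weakDerivNorm Ω (Pi.single i 1) 2 u ^ 2)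
      (fun _ _ => zero_le) (Finset.mem_univ i)
  have habs : ∀ v : Plane → ℝ, eLpNorm (fun x => |v x|) 2 (volume.restrict Ω) = L2Norm Ω v :=
    fun v => eLpNorm_norm v
  calc L2Norm Ω f ≤ ENNReal.ofReal c * eLpNorm
        (((fun x => |u x|) + fun x => |pderiv 0 u x|) + fun x => |pderiv 1 u x|) 2
          (volume.restrict Ω) := by
        refine eLpNorm_le_mul_eLpNorm_of_ae_le_mul ?_ 2
        filter_upwards [hf] with x hx
        simp only [Pi.add_apply, Real.norm_eq_abs]
        rwa [abs_of_nonneg (by positivity : 0 ≤ |u x| + |pderiv 0 u x| + |pderiv 1 u x|)]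
    _ ≤ ENNReal.ofReal c * (3 * H1Norm Ω u) := by
        gcongr
        refine (eLpNorm_add_le (hu.norm.add (hm 0)) (hm 1) (by norm_num)).trans ?_
        refine (add_le_add_left (eLpNorm_add_le hu.norm (hm 0) (by norm_num)) _).trans ?_
        rw [habs, habs]
        simp only [Real.norm_eq_abs]
        rw [habs]
        refine (add_le_add (add_le_add hu' (hp' 0)) (hp' 1)).trans_eq ?_
        ring

end P1FEM

/-! ### The theorem. -/

open P1FEM in
theorem lemma4p6 (Ω : Set Plane) (hΩ : IsPolygonalDomain Ω)
    (𝒯₀ : Finset Tri) (h𝒯₀ : IsTriangulation 𝒯₀ Ω) (h₀ : ℝ) (hh₀ : 0 < h₀) :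
    ∃ C : ℝ, 0 < C ∧ ∀ ρ : Plane → ℝ, MemSobolev Ω 2 ∞ ρ →
      ∃ ρc : Plane → ℝ, ContinuousOn ρc Ω ∧ ρc =ᵐ[volume.restrict Ω] ρ ∧
        ∀ (k : ℕ) (h : ℝ), h = h₀ / 2 ^ k → ∀ u ∈ FESpace Ω (mesh 𝒯₀ k),
          L2Norm Ω (mulOp ρ u - discMulOp Ω (mesh 𝒯₀ k) (interp Ω (mesh 𝒯₀ k) ρc) u) ≤
            ENNReal.ofReal (C * h ^ 2) * W2infQuotNorm Ω ρ * H1Norm Ω u := by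
  obtain ⟨hopen, -, hbdd, -⟩ := hΩ
  obtain ⟨R, hR, hRΩ⟩ := hbdd.closure.exists_pos_norm_le
  set D := R + R
  have hD : 0 < D := by positivity
  have hdiam : ∀ t ∈ 𝒯₀, ∀ i j, ‖t.points i - t.points j‖ ≤ D := by
    intro t ht i j
    have hcl : ∀ i, t.points i ∈ closure Ω := fun i =>
      h𝒯₀.closedInterior_subset_closure (k := 0) ht (t.point_mem_closedInterior i)
    exact (norm_sub_le _ _).trans (add_le_add (hRΩ _ (hcl i)) (hRΩ _ (hcl j)))
  -- The 3 comes from `L2Norm_le_mul_H1Norm`, the factor `4 + 4 * D` from the pointwise bound with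
  -- `d ≤ D`, and `D ^ 2 / h₀ ^ 2` converts `h` into the edge bound `d = D / 2 ^ k`.
  refine ⟨3 * (4 + 4 * D) * D ^ 2 / h₀ ^ 2, by positivity, fun ρ hρ => ?_⟩
  obtain ⟨f, hf⟩ := hρ.exists_smoothApprox hopen hbdd
  set K := (W2infQuotNorm Ω ρ).toReal with hKdef
  have hK : 0 ≤ K := ENNReal.toReal_nonneg
  obtain ⟨ρc, hρc, hae, hlim⟩ := hf.exists_continuousOn hopen hK
  refine ⟨ρc, hρc, hae, ?_⟩
  rintro k _ rfl u hu
  set d := D / 2 ^ k with hd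
  have hd0 : 0 < d := by positivity
  have hdD : d ≤ D := div_le_self hD.le (one_le_pow₀ one_le_two)
  have hpt : ∀ᵐ x ∂volume.restrict Ω,
      |(mulOp ρ u - discMulOp Ω (mesh 𝒯₀ k) (interp Ω (mesh 𝒯₀ k) ρc) u) x| ≤
        (K * ((4 + 4 * D) * d ^ 2)) * (|u x| + |pderiv 0 u x| + |pderiv 1 u x|) := by
    filter_upwards [hae, ae_restrict_mem hopen.measurableSet,
      ae_restrict_of_ae (h𝒯₀.ae_mem_interior k)] with x hx hxΩ hxt
    obtain ⟨t, ht, hxt⟩ := hxt hxΩ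
    rw [Pi.sub_apply, mulOp, ← hx]
    refine (hf.abs_mulOp_sub_discMulOp_le hopen hρc hlim (h𝒯₀.consistent_mesh k) hu ht
      (h𝒯₀.interior_subset_domain ht) (h𝒯₀.closedInterior_subset_closure ht)
      (dist_points_le_of_mem_mesh hdiam k t ht) hxt).trans ?_
    rw [mul_assoc K]
    refine mul_le_mul_of_nonneg_left ?_ hK
    rw [← hd]
    set G := |pderiv 0 u x| + |pderiv 1 u x| with hG
    have hG0 : 0 ≤ G := by positivity
    have h1 : G * d ≤ G * D := mul_le_mul_of_nonneg_left hdD hG0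
    have h2 : 0 ≤ D * |u x| := by positivity
    have : 2 * G + 4 * (|u x| + G * d) ≤ (4 + 4 * D) * (|u x| + G) := by linarith
    calc 2 * (G * d) * d + 4 * (|u x| + G * d) * d ^ 2
        = (2 * G + 4 * (|u x| + G * d)) * d ^ 2 := by ring
      _ ≤ (4 + 4 * D) * (|u x| + G) * d ^ 2 := by gcongr
      _ = _ := by rw [hG]; ring
  refine (L2Norm_le_mul_H1Norm
    ((hu.1.mono subset_closure).aestronglyMeasurable hopen.measurableSet)
    (h𝒯₀.L2Norm_pderiv_le hopen hu) hpt).trans_eq ?_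
  have e : 3 * (4 + 4 * D) * D ^ 2 / h₀ ^ 2 * (h₀ / 2 ^ k) ^ 2 = 3 * ((4 + 4 * D) * d ^ 2) := by
    rw [hd]
    field_simp
  rw [e, ENNReal.ofReal_mul hK, ENNReal.ofReal_mul (by norm_num : (0 : ℝ) ≤ 3), hKdef,
    ENNReal.ofReal_toReal hρ.W2infQuotNorm_lt_top.ne, ENNReal.ofReal_ofNat]
  ring
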